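/- **Setting.** Let $\mathbf X=(X_t)_{t\in\mathbb R}$ be a real process on a probability space $(\Omega,\mathcal F,P)$, $\mathcal F_{\le s}=\sigma(X_r:r\le s)$. It is a *stationary Markov process with polynomial regression* (SMPR) if: all $X_t$ have the same law $\mu$; there are probability kernels $\eta(\cdot\,|\,y,\tau)$, $\tau\ge 0$, with $P(X_{s+\tau}\in B\,|\,\mathcal F_{\le s})=\eta(B\,|\,X_s,\tau)$ a.s. for all $s$ and all Borel $B$; $\mu$ has all moments and is the only measure on $\mathbb R$ with these moments; and, with $\nu\in\{1,2,\dots\}\cup\{\infty\}$ the number of points of $\operatorname{supp}\mu$, * for all $0<n<\nu$ and distinct $s_1,\dots,s_n$ the matrix $[\operatorname{cov}(X_{s_i},X_{s_j})]_{i,j\le n}$ is nonsingular; * for all $m,j\ge 0$ and all $s$, $t\mapsto E X_t^mX_s^j$ is continuous at $t=s$; * there are functions $\gamma_{n,j}$ with $E(X_{s+\tau}^n|\mathcal F_{\le s})=\sum_{j=0}^n\gamma_{n,j}(\tau)X_s^j$ a.s. for all $s$, $\tau>0$ and $n<\nu$; * the lower triangular matrices $\mathbf A_n(\tau)=[\gamma_{i,j}(\tau)]_{0\le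 j\le i\le n}$, $n<\nu$, $\tau>0$, are diagonalizable over $\mathbb R$. It is *regular* (RSMPR) if there are monic polynomials $p_n$ of degree $n$ ($n<\nu$), mutually orthogonal in $L_2(\mu)$, such that, with $\mathbf W_n$ the matrix of coefficients of $p_0,\dots,p_n$, every $\mathbf W_n\mathbf A_n(\tau)\mathbf W_n^{-1}$ ($n<\nu$, $\tau>0$) is diagonal. **Theorem.** Let $\mathbf X$ be an RSMPR process, with $\mu$, $\eta$, $\nu$ as above. Then there are polynomials $h_n$ of degree $n$ and constants $\alpha_n\ge 0$ ($0\le n<\nu$), $h_0=1$, $\alpha_0=0$, such that the following hold; all sums are over $0\le n<\nu$. 1. The $h_n$ form an orthonormal basis of $L_2(\mu)$. For each $n<\nu$, $\left(e^{\alpha_nt}h_n(X_t),\mathcal F_{\le t}\right)_{t\in\mathbb R}$ is a martingale, and these martingales are mutually orthogonal: $E\left[e^{\alpha_ms}h_m(X_s)\,e^{\alpha_nt}h_n(X_t)\right]=0$ for $m\ne n$ and all $s,t$. 2. For $f=\sum c_nh_n\in L_2(\mu)$ and $t\ge0$ put $U^tf=\sum e^{-\alpha_nt}c_nh_n$ (convergence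 in $L_2(\mu)$). Then $(U^t)_{t\ge0}$ is a strongly continuous semigroup of bounded operators on $L_2(\mu)$, and it is the transition semigroup of $\mathbf X$: for all $f\in L_2(\mu)$ and $t\ge 0$, $E(f(X_t)|X_0)=(U^tf)(X_0)$ and, for every $s$, $E(f(X_{s+t})|\mathcal F_{\le s})=(U^tf)(X_s)$ a.s., and for $\mu$-a.e. $y$, $f$ is $\eta(\cdot|y,t)$-integrable and $(U^tf)(y)=\int f(x)\,\eta(dx|y,t)$. 3. The infinitesimal generator $A$ of $(U^t)$ has domain $D_A=\{f=\sum c_nh_n\in L_2(\mu):\sum c_n^2\alpha_n^2<\infty\}$, and $Af=-\sum\alpha_nc_nh_n$ for $f\in D_A$. 4. For every $t\ge0$ and $\mu$-a.e. $y$: if $\eta(\cdot|y,t)\ll\mu$ and $\int\left(\frac{d\eta(\cdot|y,t)}{d\mu}\right)^2d\mu<\infty$, then $$\frac{d\eta}{d\mu}(x|y,t)=\sum e^{-\alpha_nt}h_n(x)h_n(y)$$ with convergence in $L_2(\mu)$ as functions of $x$. If, for a given $t\ge0$, $\eta(\cdot|y,t)$ has for $\mu$-a.e. $y$ the density $g(\cdot,y)$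 with respect to $\mu$, with $g$ jointly measurable and $\iint g^2\,d\mu\,d\mu<\infty$, then $g(x,y)=\sum e^{-\alpha_nt}h_n(x)h_n(y)$ with convergence in $L_2(\mu\otimes\mu)$. Moreover the system $\{(\alpha_n,h_n)\}$ determines the process. Let $\mathbf X'$ be another RSMPR process, possibly on another probability space, with stationary law $\mu'$, and suppose that either $\operatorname{supp}\mu$ and $\operatorname{supp}\mu'$ are both infinite, or $\operatorname{supp}\mu=\operatorname{supp}\mu'$. If, for some polynomials $h_n$ with $\deg h_n=n$ and some $\alpha_n\ge0$ ($n<\nu$), the $h_n$ are orthonormal for $\mu$ and for $\mu'$, and $e^{\alpha_nt}h_n(X_t)$ and $e^{\alpha_nt}h_n(X'_t)$ are mutually orthogonal martingales in the sense of 1, each with respect to the past of its own process, then $\mathbf X$ and $\mathbf X'$ have the same finite-dimensional distributions. -/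

import Mathlib

open MeasureTheory ProbabilityTheory Filter Topology
open scoped ENNReal NNReal

universe u v

namespace PolyRegression

/-- The number `ν` of points of the support of a measure on the line (`⊤` if it is infinite). -/
noncomputable def supportSize (μ : Measure ℝ) : ℕ∞ := μ.support.encard

/-- The indices `n = 0, 1, 2, …` with `n < ν`; all of `ℕ` if the support is infinite. -/
abbrev Idx (μ : Measure ℝ) : Type := {n : ℕ // (n : ℕ∞) < supportSize μ}

/-- All moments of `μ` are finite, and `μ` is the only measure on the line with these moments. -/
def IdentifiableByMoments (μ : Measure ℝ) : Prop :=
  (∀ n : ℕ, Integrable (fun x : ℝ => x ^ n) μ) ∧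
  ∀ ρ : Measure ℝ, (∀ n : ℕ, Integrable (fun x : ℝ => x ^ n) ρ) →
    (∀ n : ℕ, ∫ x, x ^ n ∂ρ = ∫ x, x ^ n ∂μ) → ρ = μ

/-- The structural matrix `A_n(τ)`, with entries `γ_{i,j}(τ)` for `j ≤ i ≤ n` and `0` above the
diagonal. -/
def structuralMatrix (γ : ℕ → ℕ → ℝ → ℝ) (n : ℕ) (τ : ℝ) :
    Matrix (Fin (n + 1)) (Fin (n + 1)) ℝ :=
  Matrix.of fun i j => if j ≤ i then γ i j τ else 0

/-- The matrix whose rows are the coefficients of `p_0, …, p_n`. -/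
noncomputable def coeffMatrix (p : ℕ → Polynomial ℝ) (n : ℕ) :
    Matrix (Fin (n + 1)) (Fin (n + 1)) ℝ :=
  Matrix.of fun i j => (p i).coeff j

/-- A real square matrix is diagonalizable (over the reals). -/
def IsDiagonalizable {k : ℕ} (M : Matrix (Fin k) (Fin k) ℝ) : Prop :=
  ∃ (V : Matrix (Fin k) (Fin k) ℝ) (d : Fin k → ℝ), IsUnit V.det ∧
    M = V * Matrix.diagonal d * V⁻¹

/-- `X` is a stationary Markov process with polynomial regression on `(Ω, P)`, with one-dimensional
law `μ`, transition kernels `η τ y = η(· | y, τ)` and regression coefficients `γ`. -/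
structure IsSMPR {Ω : Type u} [MeasurableSpace Ω] (P : Measure Ω) (X : ℝ → Ω → ℝ)
    (hX : ∀ t, StronglyMeasurable (X t)) (μ : Measure ℝ) (η : ℝ≥0 → Kernel ℝ ℝ)
    (γ : ℕ → ℕ → ℝ → ℝ) : Prop where
  law_eq : ∀ t, P.map (X t) = μ
  isMarkovKernel : ∀ τ, IsMarkovKernel (η τ)
  /-- Markov property, with transition probabilities that depend only on the time lag. -/
  markov : ∀ (s : ℝ) (τ : ℝ≥0) (B : Set ℝ), MeasurableSet B →
    P[(X (s + τ) ⁻¹' B).indicator (fun _ => (1 : ℝ)) | Filtration.natural X hX s]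
      =ᵐ[P] fun ω => (η τ (X s ω)).real B
  identifiable : IdentifiableByMoments μ
  /-- Total linear independence. -/
  tld : ∀ n : ℕ, 0 < n → (n : ℕ∞) < supportSize μ → ∀ s : Fin n → ℝ, Function.Injective s →
    (Matrix.of fun i j => cov[X (s i), X (s j); P]).det ≠ 0
  /-- Mean-square continuity. -/
  msc : ∀ (m j : ℕ) (s : ℝ), ContinuousAt (fun t => ∫ ω, X t ω ^ m * X s ω ^ j ∂P) s
  /-- Polynomial regression. -/
  regression : ∀ n : ℕ, (n : ℕ∞) < supportSize μ → ∀ s τ : ℝ, 0 < τ →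
    P[fun ω => X (s + τ) ω ^ n | Filtration.natural X hX s]
      =ᵐ[P] fun ω => ∑ j ∈ Finset.range (n + 1), γ n j τ * X s ω ^ j
  diagonalizable : ∀ n : ℕ, (n : ℕ∞) < supportSize μ → ∀ τ : ℝ, 0 < τ →
    IsDiagonalizable (structuralMatrix γ n τ)

/-- `X` is a regular SMPR process: the structural matrices are simultaneously diagonalized by the
coefficient matrices of monic polynomials `p_n`, `deg p_n = n`, which are mutually orthogonal
with respect to the stationary law `μ`. -/
def IsRSMPR {Ω : Type u} [MeasurableSpace Ω] (P : Measure Ω) (X : ℝ → Ω → ℝ)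
    (hX : ∀ t, StronglyMeasurable (X t)) (μ : Measure ℝ) (η : ℝ≥0 → Kernel ℝ ℝ) : Prop :=
  ∃ γ : ℕ → ℕ → ℝ → ℝ, IsSMPR P X hX μ η γ ∧
    ∃ p : ℕ → Polynomial ℝ,
      (∀ n : ℕ, (n : ℕ∞) < supportSize μ → (p n).Monic ∧ (p n).natDegree = n) ∧
      (∀ n : ℕ, (n : ℕ∞) < supportSize μ → ∀ τ : ℝ, 0 < τ → ∃ d : Fin (n + 1) → ℝ,
        structuralMatrix γ n τ =
          (coeffMatrix p n)⁻¹ * Matrix.diagonal d * coeffMatrix p n) ∧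
      (∀ m n : ℕ, (m : ℕ∞) < supportSize μ → (n : ℕ∞) < supportSize μ → m ≠ n →
        ∫ x, (p m).eval x * (p n).eval x ∂μ = 0)

/-- The polynomials `h_n`, `deg h_n = n`, are orthonormal for `μ`, the `α_n` are nonnegative, and
the processes `exp(α_n t) h_n(X_t)` are martingales and mutually orthogonal (here `n < ν`). -/
structure IsMartingaleSystem {Ω : Type u} [MeasurableSpace Ω] (P : Measure Ω) (X : ℝ → Ω → ℝ)
    (hX : ∀ t, StronglyMeasurable (X t)) (μ : Measure ℝ)
    (h : ℕ → Polynomial ℝ) (α : ℕ → ℝ) : Prop where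
  natDegree_eq : ∀ n : Idx μ, (h n).natDegree = n
  orthonormal : ∀ m n : Idx μ,
    ∫ x, (h m).eval x * (h n).eval x ∂μ = if m = n then 1 else 0
  nonneg : ∀ n : Idx μ, 0 ≤ α n
  martingale : ∀ n : Idx μ,
    Martingale (fun t ω => Real.exp (α n * t) * (h n).eval (X t ω)) (Filtration.natural X hX) P
  orthogonal : ∀ m n : Idx μ, m ≠ n → ∀ s t : ℝ,
    ∫ ω, (Real.exp (α m * s) * (h m).eval (X s ω)) *
      (Real.exp (α n * t) * (h n).eval (X t ω)) ∂P = 0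

/-- A strongly continuous one-parameter semigroup of bounded operators. -/
structure IsStronglyContinuousSemigroup {E : Type*} [NormedAddCommGroup E] [NormedSpace ℝ E]
    (U : ℝ≥0 → E →L[ℝ] E) : Prop where
  map_zero : U 0 = ContinuousLinearMap.id ℝ E
  map_add : ∀ s t, U (s + t) = (U s).comp (U t)
  continuous : ∀ f, Continuous fun t => U t f

/-- `A` is the infinitesimal generator of `U`: its domain consists of all `f` for which
`(U^t f - f) / t` converges in norm as `t ↓ 0`, and `A f` is the limit. -/
def IsInfinitesimalGenerator {E : Type*} [NormedAddCommGroup E] [NormedSpace ℝ E]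
    (U : ℝ≥0 → E →L[ℝ] E) (A : E →ₗ.[ℝ] E) : Prop :=
  (∀ f : E, f ∈ A.domain ↔
    ∃ g : E, Tendsto (fun t : ℝ≥0 => (t : ℝ)⁻¹ • (U t f - f)) (𝓝[>] 0) (𝓝 g)) ∧
  ∀ f : A.domain,
    Tendsto (fun t : ℝ≥0 => (t : ℝ)⁻¹ • (U t (f : E) - (f : E))) (𝓝[>] 0) (𝓝 (A f))

/-- Two real processes indexed by `ℝ` have the same finite-dimensional distributions. -/
def SameFiniteDimensionalLaws {Ω : Type u} {Ω' : Type v} [MeasurableSpace Ω] [MeasurableSpace Ω']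
    (P : Measure Ω) (X : ℝ → Ω → ℝ) (P' : Measure Ω') (X' : ℝ → Ω' → ℝ) : Prop :=
  ∀ I : Finset ℝ, P.map (fun ω (i : I) => X i ω) = P'.map (fun ω (i : I) => X' i ω)

end PolyRegression

/-!
The proof rests on the density of the polynomials in `L²(μ)` for a determinate `μ`, a theorem of
M. Riesz. By the Riesz extension theorem and the representation of positive functionals by
measures, `1 / (1 + x ^ 2)` is approximated from below in `L¹(μ)` by polynomials `p`
(`IdentifiableByMoments.exists_polynomial_le`), since otherwise a second measure would have the
moments of `μ`. The nonnegative polynomial `1 - (1 + x ^ 2) p` is the squared modulus of a complex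
polynomial that is not small at `i`, so division by `x - i` gives polynomials close to `1 / (x - i)`
in the mean square (`exists_polynomial_sq_le`). The closure of the polynomials is therefore stable
under multiplication by the real and imaginary parts of `1 / (x - i)`, and an algebra of bounded
functions that separates points leaves no room for an orthogonal complement
(`IdentifiableByMoments.ae_eq_zero_of_orthogonal`). When the support has `ν` points, polynomials of
degree less than `ν` suffice.

For a regular process the polynomial `p_n` is an eigenfunction of regression
(`IsSMPR.condExp_eval_eq`). As a function of the time lag its eigenvalue is multiplicative, bounded
by `1` in modulus by stationarity, and continuous at `0`, so it is `exp (-α n τ)` with `α n ≥ 0`.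
The normalized `p_n` form a martingale system (`IsRSMPR.exists_isMartingaleSystem`) and a Hilbert
basis. The diagonal semigroup with eigenvalues `exp (-α n t)` agrees with regression on the basis,
hence everywhere (`IsMartingaleSystem.condExp_eq_semigroup`), and comparison with the joint law of
two states identifies it with integration against the kernels. The generator is the diagonal
operator on its maximal domain, and the densities are expanded by computing their Fourier
coefficients, with Bessel's inequality as domination in the two-variable case.

For the uniqueness, the orthonormal polynomials determine the integrals of polynomials and so the
law (`IsOrthonormalSystem.measure_unique`). The transition semigroup depends only on the polynomials
and the constants, and with the stationary law it determines the finite-dimensional distributions,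
by adding time points in increasing order.
-/

namespace PolyRegression

/-! ### Nonnegative polynomials on the line -/

open Polynomial in
/-- A nonnegative polynomial on the line is the squared modulus of a complex polynomial. Moving each
nonreal root to the lower half plane makes the modulus of the latter at `i` as large as possible. -/
lemma exists_normSq_eq_of_nonneg (q : ℝ[X]) (hq : ∀ x : ℝ, 0 ≤ q.eval x) :
    ∃ r : ℂ[X], (∀ x : ℝ, ‖r.eval (x : ℂ)‖ ^ 2 = q.eval x) ∧
      ‖aeval Complex.I q‖ ≤ ‖r.eval Complex.I‖ ^ 2 := by
  induction hn : q.natDegree using Nat.strong_induction_on generalizing q with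
  | _ n ih =>
  rcases Nat.eq_zero_or_pos n with h0 | hpos
  · obtain ⟨c, rfl⟩ : ∃ c, C c = q := ⟨_, (eq_C_of_natDegree_eq_zero (hn.trans h0)).symm⟩
    have hc : 0 ≤ c := by simpa using hq 0
    refine ⟨C ((√c : ℝ) : ℂ), fun x => ?_, ?_⟩
    · simp [Real.sq_sqrt hc]
    · simp [Real.sq_sqrt hc, abs_of_nonneg hc]
  · have hdeg : (q.map (algebraMap ℝ ℂ)).degree ≠ 0 := by
      rw [degree_map]
      exact (natDegree_pos_iff_degree_pos.1 (hn ▸ hpos)).ne'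
    obtain ⟨w, hw⟩ := IsAlgClosed.exists_root _ hdeg
    have hw' : aeval w q = 0 := by rwa [IsRoot, eval_map_algebraMap] at hw
    have hq0 : q ≠ 0 := by rintro rfl; simp at hn; omega
    -- It suffices to split off a nonnegative quadratic factor that is itself a squared modulus.
    have key : ∀ (s q₁ : ℝ[X]) (z : ℂ), q = s * q₁ → s.natDegree = 2 →
        (∀ x : ℝ, s.eval x = ‖(x : ℂ) - z‖ ^ 2) → (∀ x : ℝ, 0 ≤ q₁.eval x) →
        ‖aeval Complex.I s‖ ≤ ‖Complex.I - z‖ ^ 2 → ∃ r : ℂ[X],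
          (∀ x : ℝ, ‖r.eval (x : ℂ)‖ ^ 2 = q.eval x) ∧
          ‖aeval Complex.I q‖ ≤ ‖r.eval Complex.I‖ ^ 2 := by
      intro s q₁ z hs hs2 hsz hq₁ hI
      have hne : s ≠ 0 ∧ q₁ ≠ 0 := by
        constructor <;> rintro rfl <;> simp at hs <;> exact hq0 hs
      have hlt : q₁.natDegree < n := by
        rw [← hn, hs, natDegree_mul hne.1 hne.2, hs2]; omega
      obtain ⟨r, hr1, hr2⟩ := ih _ hlt q₁ hq₁ rfl
      refine ⟨(X - C z) * r, fun x => ?_, ?_⟩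
      · rw [hs, eval_mul, eval_mul, norm_mul, mul_pow, hr1, hsz]; simp
      · rw [hs, map_mul, eval_mul, norm_mul, norm_mul, mul_pow]
        simp only [eval_sub, eval_X, eval_C]
        gcongr
    by_cases him : w.im = 0
    · obtain ⟨a, rfl⟩ : ∃ a : ℝ, (a : ℂ) = w := ⟨w.re, by apply Complex.ext <;> simp [him]⟩
      have ha : q.IsRoot a := by
        have : ((q.eval a : ℝ) : ℂ) = 0 := by
          rw [← hw', ← Complex.coe_algebraMap, aeval_algebraMap_apply, coe_aeval_eq_eval]
        exact_mod_cast this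
      obtain ⟨q₀, hq₀⟩ := dvd_iff_isRoot.2 ha
      have h1 : q₀.IsRoot a := by
        apply le_antisymm
        · have hc : Tendsto (fun x => q₀.eval x) (𝓝[<] a) (𝓝 (q₀.eval a)) :=
            q₀.continuous.continuousAt.tendsto.mono_left nhdsWithin_le_nhds
          refine le_of_tendsto hc ?_
          filter_upwards [self_mem_nhdsWithin] with x (hx : x < a)
          have := hq x
          rw [hq₀, eval_mul] at this
          simp only [eval_sub, eval_X, eval_C] at this
          nlinarith
        · have hc : Tendsto (fun x => q₀.eval x) (𝓝[>] a) (𝓝 (q₀.eval a)) :=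
            q₀.continuous.continuousAt.tendsto.mono_left nhdsWithin_le_nhds
          refine ge_of_tendsto hc ?_
          filter_upwards [self_mem_nhdsWithin] with x (hx : a < x)
          have := hq x
          rw [hq₀, eval_mul] at this
          simp only [eval_sub, eval_X, eval_C] at this
          nlinarith
      obtain ⟨q₁, hq₁⟩ := dvd_iff_isRoot.2 h1
      have hfac : q = (X - C a) ^ 2 * q₁ := by rw [hq₀, hq₁]; ring
      refine key ((X - C a) ^ 2) q₁ a hfac (by simp) (fun x => ?_) ?_ ?_
      · rw [← Complex.ofReal_sub, Complex.norm_real]; simp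
      · have hcl : IsClosed {x : ℝ | 0 ≤ q₁.eval x} := isClosed_le continuous_const q₁.continuous
        have hsub : {a}ᶜ ⊆ {x : ℝ | 0 ≤ q₁.eval x} := by
          intro x hx
          have h2 := hq x
          rw [hfac, eval_mul] at h2
          have h3 : 0 < ((X - C a) ^ 2 : ℝ[X]).eval x := by
            simp only [eval_pow, eval_sub, eval_X, eval_C]
            exact sq_pos_iff.2 (sub_ne_zero.2 hx)
          exact nonneg_of_mul_nonneg_right h2 h3
        intro x
        have := (dense_compl_singleton a).closure_eq ▸ hcl.closure_subset_iff.2 hsub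
        exact this (Set.mem_univ x)
      · simp
    · have hdvd := quadratic_dvd_of_aeval_eq_zero_im_ne_zero q hw' him
      obtain ⟨q₁, hq₁⟩ := hdvd
      have hs : ∀ (x : ℝ) (z : ℂ), z.re = w.re → z.im ^ 2 = w.im ^ 2 →
          (X ^ 2 - C (2 * w.re) * X + C (‖w‖ ^ 2) : ℝ[X]).eval x = ‖(x : ℂ) - z‖ ^ 2 := by
        intro x z h1 h2
        rw [Complex.sq_norm, Complex.normSq_apply, ← Complex.normSq_eq_norm_sq,
          Complex.normSq_apply]
        simp [h1]
        linear_combination -h2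
      refine key _ q₁ ⟨w.re, -|w.im|⟩ hq₁ ?_ (fun x => hs x _ rfl (by simp)) ?_ ?_
      · compute_degree!
      · intro x
        have h2 := hq x
        rw [hq₁, eval_mul, hs x w rfl rfl] at h2
        have h3 : 0 < ‖(x : ℂ) - w‖ ^ 2 := by
          apply pow_pos
          rw [norm_pos_iff]
          intro h
          apply him
          simpa using congrArg Complex.im h
        exact nonneg_of_mul_nonneg_right h2 h3
      · have e : aeval Complex.I (X ^ 2 - C (2 * w.re) * X + C (‖w‖ ^ 2) : ℝ[X])
            = (Complex.I - w) * (Complex.I - (starRingEnd ℂ) w) := by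
          have h1 : (‖w‖ : ℂ) ^ 2 = w * (starRingEnd ℂ) w := by
            rw [Complex.mul_conj, Complex.normSq_eq_norm_sq]; push_cast; rfl
          have h2 : 2 * (w.re : ℂ) = w + (starRingEnd ℂ) w := by
            rw [Complex.add_conj]; push_cast; rfl
          simp only [map_add, map_sub, map_mul, map_pow, aeval_X, aeval_C, Complex.coe_algebraMap,
            Complex.ofReal_ofNat]
          linear_combination h1 - Complex.I * h2
        rw [e, norm_mul]
        have l1 : ‖Complex.I - w‖ ≤ ‖Complex.I - ⟨w.re, -|w.im|⟩‖ := by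
          rw [Complex.norm_def, Complex.norm_def]
          apply Real.sqrt_le_sqrt
          simp only [Complex.normSq_apply, Complex.sub_re, Complex.I_re, Complex.sub_im,
            Complex.I_im]
          nlinarith [neg_abs_le w.im, abs_mul_abs_self w.im]
        have l2 : ‖Complex.I - (starRingEnd ℂ) w‖ ≤ ‖Complex.I - ⟨w.re, -|w.im|⟩‖ := by
          rw [Complex.norm_def, Complex.norm_def]
          apply Real.sqrt_le_sqrt
          simp only [Complex.normSq_apply, Complex.sub_re, Complex.I_re, Complex.sub_im,
            Complex.I_im, Complex.conj_re, Complex.conj_im]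
          nlinarith [le_abs_self w.im, abs_mul_abs_self w.im]
        rw [sq]
        gcongr

/-! ### Approximation from below under determinacy -/

/-- The space of continuous functions of polynomial growth on the line. -/
def polyGrowth : Submodule ℝ (ℝ → ℝ) where
  carrier := {f | Continuous f ∧ ∃ (n : ℕ) (C : ℝ), 0 ≤ C ∧ ∀ x, |f x| ≤ C * (1 + x ^ 2) ^ n}
  zero_mem' := ⟨continuous_const, 0, 0, le_rfl, by simp⟩
  add_mem' := by
    rintro f g ⟨hf, n, C, hC, hfC⟩ ⟨hg, m, D, hD, hgD⟩
    refine ⟨hf.add hg, max n m, C + D, by positivity, fun x => ?_⟩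
    have h1 : (1 : ℝ) ≤ 1 + x ^ 2 := by nlinarith [sq_nonneg x]
    calc |f x + g x| ≤ |f x| + |g x| := abs_add_le _ _
      _ ≤ C * (1 + x ^ 2) ^ n + D * (1 + x ^ 2) ^ m := add_le_add (hfC x) (hgD x)
      _ ≤ C * (1 + x ^ 2) ^ max n m + D * (1 + x ^ 2) ^ max n m := by
          gcongr <;> simp
      _ = _ := by ring
  smul_mem' := by
    rintro c f ⟨hf, n, C, hC, hfC⟩
    refine ⟨hf.const_smul c, n, |c| * C, by positivity, fun x => ?_⟩
    rw [Pi.smul_apply, smul_eq_mul, abs_mul, mul_assoc]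
    exact mul_le_mul_of_nonneg_left (hfC x) (abs_nonneg c)

lemma one_add_sq_pow_mem_polyGrowth (n : ℕ) : (fun x : ℝ => (1 + x ^ 2) ^ n) ∈ polyGrowth :=
  ⟨by fun_prop, n, 1, zero_le_one, fun x => by rw [one_mul, abs_of_nonneg (by positivity)]⟩

lemma eval_mem_polyGrowth (p : Polynomial ℝ) : (fun x => p.eval x) ∈ polyGrowth := by
  induction p using Polynomial.induction_on' with
  | add p q hp hq =>
    convert polyGrowth.add_mem hp hq using 1
    ext x
    simp
  | monomial n a =>
    refine ⟨by fun_prop, n, |a|, abs_nonneg a, fun x => ?_⟩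
    simp only [Polynomial.eval_monomial, abs_mul, abs_pow]
    gcongr
    nlinarith [sq_nonneg (|x| - 1), sq_abs x]

lemma mem_polyGrowth_of_abs_le {f g : ℝ → ℝ} (hf : Continuous f) (hg : g ∈ polyGrowth)
    (h : ∀ x, |f x| ≤ |g x|) : f ∈ polyGrowth := by
  obtain ⟨-, n, C, hC, hgC⟩ := hg
  exact ⟨hf, n, C, hC, fun x => (h x).trans (hgC x)⟩

lemma inv_one_add_sq_mem_polyGrowth : (fun x : ℝ => (1 + x ^ 2)⁻¹) ∈ polyGrowth := by
  refine mem_polyGrowth_of_abs_le ?_ (one_add_sq_pow_mem_polyGrowth 0) fun x => ?_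
  · exact Continuous.inv₀ (by fun_prop) fun x => by positivity
  · rw [abs_of_nonneg (by positivity)]
    simpa using inv_le_one_of_one_le₀ (by nlinarith [sq_nonneg x] : (1 : ℝ) ≤ 1 + x ^ 2)

lemma integrable_eval_of_pow {μ : Measure ℝ} (hμ : ∀ n : ℕ, Integrable (fun x : ℝ => x ^ n) μ)
    (p : Polynomial ℝ) : Integrable (fun x => p.eval x) μ := by
  induction p using Polynomial.induction_on' with
  | add p q hp hq =>
    refine (hp.add hq).congr (ae_of_all _ fun x => ?_)
    simp
  | monomial n a => simpa only [Polynomial.eval_monomial] using (hμ n).const_mul a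

lemma integrable_of_mem_polyGrowth {μ : Measure ℝ}
    (hμ : ∀ n : ℕ, Integrable (fun x : ℝ => x ^ n) μ) {f : ℝ → ℝ} (hf : f ∈ polyGrowth) :
    Integrable f μ := by
  obtain ⟨hc, n, C, hC, hfC⟩ := hf
  have h := integrable_eval_of_pow hμ
    (Polynomial.C C * (1 + Polynomial.X ^ 2) ^ n)
  refine h.mono' hc.aestronglyMeasurable (ae_of_all _ fun x => ?_)
  simpa using hfC x

/-- The continuous function that is `1` on `[-N, N]`, vanishes off `[-N - 1, N + 1]` and is linear
in between. -/
def cutoff (N : ℕ) (x : ℝ) : ℝ := max 0 (min 1 (N + 1 - |x|))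

lemma continuous_cutoff (N : ℕ) : Continuous (cutoff N) := by unfold cutoff; fun_prop

lemma cutoff_nonneg (N : ℕ) (x : ℝ) : 0 ≤ cutoff N x := le_max_left _ _

lemma cutoff_le_one (N : ℕ) (x : ℝ) : cutoff N x ≤ 1 := by simp [cutoff]

lemma cutoff_eq_one {N : ℕ} {x : ℝ} (h : |x| ≤ N) : cutoff N x = 1 := by
  unfold cutoff
  rw [min_eq_left (by linarith), max_eq_right zero_le_one]

lemma cutoff_eq_zero {N : ℕ} {x : ℝ} (h : x ∉ Set.Icc (-(N + 1 : ℝ)) (N + 1)) :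
    cutoff N x = 0 := by
  unfold cutoff
  rw [max_eq_left]
  have : (N : ℝ) + 1 < |x| := by
    by_contra hx
    exact h (abs_le.1 (not_lt.1 hx))
  exact (min_le_right _ _).trans (by linarith)

open CompactlySupported in
/-- A positive linear functional on the continuous functions of polynomial growth is integration
against a measure. The growth of `(1 + x ^ 2) ^ (n + 1)` controls the tails of functions of order
`n`, so that the functional is determined by its restriction to compact supports. -/
lemma exists_measure_of_positive_functional (Λ : polyGrowth →ₗ[ℝ] ℝ)
    (hΛ : ∀ f : polyGrowth, (∀ x, 0 ≤ (f : ℝ → ℝ) x) → 0 ≤ Λ f) :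
    ∃ ρ : Measure ℝ, ∀ f : polyGrowth, Integrable (f : ℝ → ℝ) ρ ∧ ∫ x, (f : ℝ → ℝ) x ∂ρ = Λ f := by
  have hmono : ∀ f g : polyGrowth, (∀ x, (f : ℝ → ℝ) x ≤ (g : ℝ → ℝ) x) → Λ f ≤ Λ g := by
    intro f g h
    have := hΛ (g - f) fun x => by simpa using h x
    rw [map_sub] at this
    linarith
  have hcc : ∀ f : C_c(ℝ, ℝ), (f : ℝ → ℝ) ∈ polyGrowth := by
    intro f
    obtain ⟨C, hC⟩ := f.hasCompactSupport.exists_bound_of_continuous f.continuous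
    refine ⟨f.continuous, 0, C, (norm_nonneg _).trans (hC 0), fun x => ?_⟩
    simpa using hC x
  let Λ₀ : C_c(ℝ, ℝ) →ₗ[ℝ] ℝ :=
    { toFun := fun f => Λ ⟨f, hcc f⟩
      map_add' := fun f g => by rw [← map_add]; rfl
      map_smul' := fun c f => by rw [RingHom.id_apply, ← map_smul]; rfl }
  let Λc : C_c(ℝ, ℝ) →ₚ[ℝ] ℝ := PositiveLinearMap.mk₀ Λ₀ fun f hf => hΛ _ fun x => hf x
  let ρ := RealRMK.rieszMeasure Λc
  have hcut : ∀ (f : polyGrowth) (N : ℕ), (fun x => cutoff N x * (f : ℝ → ℝ) x) ∈ polyGrowth := by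
    intro f N
    refine mem_polyGrowth_of_abs_le ((continuous_cutoff N).mul f.2.1) f.2 fun x => ?_
    rw [abs_mul, abs_of_nonneg (cutoff_nonneg N x)]
    exact mul_le_of_le_one_left (abs_nonneg _) (cutoff_le_one N x)
  have hsupp : ∀ (f : polyGrowth) (N : ℕ),
      HasCompactSupport (fun x => cutoff N x * (f : ℝ → ℝ) x) := by
    intro f N
    refine HasCompactSupport.intro (isCompact_Icc (a := -(N + 1 : ℝ)) (b := N + 1)) fun x hx => ?_
    rw [cutoff_eq_zero hx, zero_mul]
  have hint : ∀ (f : polyGrowth) (N : ℕ),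
      ∫ x, cutoff N x * (f : ℝ → ℝ) x ∂ρ = Λ ⟨_, hcut f N⟩ := by
    intro f N
    exact RealRMK.integral_rieszMeasure Λc
      ⟨⟨fun x => cutoff N x * (f : ℝ → ℝ) x, (hcut f N).1⟩, hsupp f N⟩
  have hcutint : ∀ (f : polyGrowth) (N : ℕ),
      Integrable (fun x => cutoff N x * (f : ℝ → ℝ) x) ρ := fun f N =>
    (hcut f N).1.integrable_of_hasCompactSupport (hsupp f N)
  let w : ℕ → polyGrowth := fun n => ⟨_, one_add_sq_pow_mem_polyGrowth n⟩
  have hw : ∀ n, Integrable (w n : ℝ → ℝ) ρ := by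
    intro n
    have hcov : AECover ρ atTop fun N : ℕ => Set.Icc (-(N : ℝ)) N :=
      aecover_Icc (tendsto_neg_atTop_atBot.comp tendsto_natCast_atTop_atTop)
        tendsto_natCast_atTop_atTop
    refine hcov.integrable_of_integral_norm_bounded (Λ (w n))
      (fun N => (w n).2.1.continuousOn.integrableOn_Icc) (Eventually.of_forall fun N => ?_)
    have hpos : ∀ x, 0 ≤ (w n : ℝ → ℝ) x := fun x => by positivity
    calc ∫ x in Set.Icc (-(N : ℝ)) N, ‖(w n : ℝ → ℝ) x‖ ∂ρ
        = ∫ x in Set.Icc (-(N : ℝ)) N, cutoff N x * (w n : ℝ → ℝ) x ∂ρ := by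
          refine setIntegral_congr_fun measurableSet_Icc fun x hx => ?_
          rw [cutoff_eq_one (abs_le.2 hx), one_mul, Real.norm_of_nonneg (hpos x)]
      _ ≤ ∫ x, cutoff N x * (w n : ℝ → ℝ) x ∂ρ :=
          setIntegral_le_integral (hcutint _ N)
            (ae_of_all _ fun x => mul_nonneg (cutoff_nonneg N x) (hpos x))
      _ = Λ ⟨_, hcut (w n) N⟩ := hint _ _
      _ ≤ Λ (w n) := hmono _ _ fun x => mul_le_of_le_one_left (hpos x) (cutoff_le_one N x)
  refine ⟨ρ, fun f => ?_⟩
  obtain ⟨hfc, n, C, hC, hfC⟩ := f.2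
  have hfi : Integrable (f : ℝ → ℝ) ρ :=
    ((hw n).const_mul C).mono' hfc.aestronglyMeasurable (ae_of_all _ fun x => hfC x)
  refine ⟨hfi, ?_⟩
  have lim1 : Tendsto (fun N : ℕ => ∫ x, cutoff N x * (f : ℝ → ℝ) x ∂ρ) atTop
      (𝓝 (∫ x, (f : ℝ → ℝ) x ∂ρ)) := by
    refine tendsto_integral_of_dominated_convergence (fun x => ‖(f : ℝ → ℝ) x‖)
      (fun N => (hcutint f N).aestronglyMeasurable) hfi.norm
      (fun N => ae_of_all _ fun x => ?_) (ae_of_all _ fun x => ?_)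
    · rw [norm_mul, Real.norm_of_nonneg (cutoff_nonneg N x)]
      exact mul_le_of_le_one_left (norm_nonneg _) (cutoff_le_one N x)
    · refine tendsto_const_nhds.congr' ?_
      filter_upwards [eventually_ge_atTop ⌈|x|⌉₊] with N hN
      rw [cutoff_eq_one ((Nat.le_ceil _).trans (by exact_mod_cast hN)), one_mul]
  have lim2 : Tendsto (fun N : ℕ => ∫ x, cutoff N x * (f : ℝ → ℝ) x ∂ρ) atTop (𝓝 (Λ f)) := by
    rw [tendsto_iff_dist_tendsto_zero]
    refine squeeze_zero' (Eventually.of_forall fun _ => dist_nonneg)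
      (g := fun N : ℕ => (C * Λ (w (n + 1))) * (N : ℝ)⁻¹) ?_ ?_
    · filter_upwards [eventually_gt_atTop 0] with N hN
      have hN1 : (1 : ℝ) ≤ N := by exact_mod_cast hN
      have hb : ∀ x, |(f : ℝ → ℝ) x - cutoff N x * (f : ℝ → ℝ) x| ≤
          ((N : ℝ)⁻¹ * C) * (1 + x ^ 2) ^ (n + 1) := by
        intro x
        rcases le_or_gt |x| N with hx | hx
        · rw [cutoff_eq_one hx, one_mul, sub_self, abs_zero]; positivity
        · have h1 : |(f : ℝ → ℝ) x - cutoff N x * (f : ℝ → ℝ) x| ≤ |(f : ℝ → ℝ) x| := by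
            rw [show (f : ℝ → ℝ) x - cutoff N x * (f : ℝ → ℝ) x
              = (1 - cutoff N x) * (f : ℝ → ℝ) x by ring, abs_mul,
              abs_of_nonneg (by linarith [cutoff_le_one N x])]
            exact mul_le_of_le_one_left (abs_nonneg _) (by linarith [cutoff_nonneg N x])
          refine h1.trans ((hfC x).trans ?_)
          have h2 : (1 : ℝ) ≤ (N : ℝ)⁻¹ * (1 + x ^ 2) := by
            rw [inv_mul_eq_div, le_div_iff₀ (by linarith)]
            nlinarith [sq_abs x]
          have h3 : 0 ≤ C * (1 + x ^ 2) ^ n := by positivity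
          calc C * (1 + x ^ 2) ^ n ≤ ((N : ℝ)⁻¹ * (1 + x ^ 2)) * (C * (1 + x ^ 2) ^ n) :=
                le_mul_of_one_le_left h3 h2
            _ = _ := by ring
      have hu := hmono (f - ⟨_, hcut f N⟩) (((N : ℝ)⁻¹ * C) • w (n + 1)) fun x => by
        simpa [w] using (abs_le.1 (hb x)).2
      have hl := hmono (-(((N : ℝ)⁻¹ * C) • w (n + 1))) (f - ⟨_, hcut f N⟩) fun x => by
        simpa [w] using (abs_le.1 (hb x)).1
      rw [map_sub, map_smul, smul_eq_mul] at hu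
      rw [map_neg, map_sub, map_smul, smul_eq_mul] at hl
      rw [hint, dist_comm, Real.dist_eq, abs_le]
      constructor <;> linarith
    · simpa using (tendsto_inv_atTop_nhds_zero_nat (𝕜 := ℝ)).const_mul (C * Λ (w (n + 1)))
  exact tendsto_nhds_unique lim1 lim2

/-- For a determinate `μ`, polynomials below `1 / (1 + x ^ 2)` have integrals arbitrarily close to
that of this function. Otherwise the moment functional extends to a positive functional, hence to a
measure with the same moments, that gives this function a smaller integral than `μ` does. -/
lemma IdentifiableByMoments.exists_polynomial_le {μ : Measure ℝ} [IsProbabilityMeasure μ]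
    (hμ : IdentifiableByMoments μ) {ε : ℝ} (hε : 0 < ε) :
    ∃ p : Polynomial ℝ, (∀ x, p.eval x ≤ (1 + x ^ 2)⁻¹) ∧
      ∫ x, (1 + x ^ 2)⁻¹ ∂μ - ε < ∫ x, p.eval x ∂μ := by
  by_contra! hcon
  set a := ∫ x, (1 + x ^ 2)⁻¹ ∂μ - ε with ha
  have hint : ∀ f : polyGrowth, Integrable (f : ℝ → ℝ) μ := fun f =>
    integrable_of_mem_polyGrowth hμ.1 f.2
  let I : polyGrowth →ₗ[ℝ] ℝ :=
    { toFun := fun f => ∫ x, (f : ℝ → ℝ) x ∂μ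
      map_add' := fun f g => integral_add (hint f) (hint g)
      map_smul' := fun c f => integral_const_mul c _ }
  let b : polyGrowth := ⟨_, inv_one_add_sq_mem_polyGrowth⟩
  let E : Polynomial ℝ →ₗ[ℝ] polyGrowth :=
    { toFun := fun p => ⟨_, eval_mem_polyGrowth p⟩
      map_add' := fun p q => by ext x; simp
      map_smul' := fun c p => by ext x; simp }
  -- Nonnegativity on this cone forces the value at `b` to be at most `a`.
  let K : PointedCone ℝ polyGrowth :=
    { carrier := {f | ∃ c : ℝ, 0 ≤ c ∧ ∀ x, c * (a - (1 + x ^ 2)⁻¹) ≤ (f : ℝ → ℝ) x}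
      zero_mem' := ⟨0, le_rfl, by simp⟩
      add_mem' := by
        rintro f g ⟨c, hc, hf⟩ ⟨d, hd, hg⟩
        refine ⟨c + d, add_nonneg hc hd, fun x => ?_⟩
        have := add_le_add (hf x) (hg x)
        simp only [Submodule.coe_add, Pi.add_apply]
        linarith
      smul_mem' := by
        rintro r f ⟨c, hc, hf⟩
        refine ⟨r * c, mul_nonneg r.2 hc, fun x => ?_⟩
        have := mul_le_mul_of_nonneg_left (hf x) r.2
        rw [mul_assoc]
        exact this }
  obtain ⟨Λ, hΛ1, hΛ2⟩ := riesz_extension K ⟨LinearMap.range E, I.domRestrict _⟩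
    (by
      rintro ⟨f, p, rfl⟩ ⟨c, hc, hf⟩
      change 0 ≤ ∫ x, p.eval x ∂μ
      have hf' : ∀ x, c * (a - (1 + x ^ 2)⁻¹) ≤ p.eval x := hf
      rcases hc.eq_or_lt with rfl | hc
      · exact integral_nonneg fun x => by simpa using hf' x
      · have h1 := hcon (Polynomial.C a - Polynomial.C c⁻¹ * p) fun x => by
          have := mul_le_mul_of_nonneg_left (hf' x) (inv_nonneg.2 hc.le)
          rw [inv_mul_cancel_left₀ hc.ne'] at this
          simp only [Polynomial.eval_sub, Polynomial.eval_C, Polynomial.eval_mul]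
          linarith
        simp only [Polynomial.eval_sub, Polynomial.eval_C, Polynomial.eval_mul] at h1
        rw [integral_sub (integrable_const _) ((integrable_eval_of_pow hμ.1 p).const_mul _),
          integral_const, integral_const_mul] at h1
        simp only [probReal_univ, one_smul] at h1
        have h2 : 0 ≤ c⁻¹ * ∫ x, p.eval x ∂μ := by linarith
        exact nonneg_of_mul_nonneg_right h2 (inv_pos.2 hc))
    (by
      intro f
      obtain ⟨-, n, C, hC, hfC⟩ := f.2
      refine ⟨⟨_, Polynomial.C C * (1 + Polynomial.X ^ 2) ^ n, rfl⟩, 0, le_rfl, fun x => ?_⟩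
      have := (abs_le.1 (hfC x)).1
      simp [E]
      linarith)
  obtain ⟨ρ, hρ⟩ := exists_measure_of_positive_functional Λ fun f hf =>
    hΛ2 f ⟨0, le_rfl, fun x => by simpa using hf x⟩
  have hp : ∀ p : Polynomial ℝ, ∫ x, p.eval x ∂ρ = ∫ x, p.eval x ∂μ := fun p =>
    (hρ (E p)).2.trans (hΛ1 ⟨_, p, rfl⟩)
  have hρμ : ρ = μ := by
    refine hμ.2 ρ (fun n => ?_) fun n => ?_
    · simpa [E] using (hρ (E (Polynomial.X ^ n))).1
    · simpa using hp (Polynomial.X ^ n)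
  have h1 : Λ b = ∫ x, (1 + x ^ 2)⁻¹ ∂μ := by rw [← (hρ b).2, hρμ]
  have h2 : Λ (E (Polynomial.C a) - b) ≥ 0 := hΛ2 _ ⟨1, zero_le_one, fun x => by simp [E, b]⟩
  have h3 : Λ (E (Polynomial.C a)) = a := by
    rw [hΛ1 ⟨_, _, rfl⟩]
    change ∫ x, (Polynomial.C a).eval x ∂μ = a
    simp
  rw [map_sub, h3, h1] at h2
  linarith

/-! ### Density of polynomials in `L²` -/

open Polynomial in
lemma exists_real_im_polynomial (s : ℂ[X]) :
    ∃ s₁ s₂ : ℝ[X], ∀ x : ℝ,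
      s.eval (x : ℂ) = ((s₁.eval x : ℝ) : ℂ) + ((s₂.eval x : ℝ) : ℂ) * Complex.I := by
  induction s using Polynomial.induction_on' with
  | add p q hp hq =>
    obtain ⟨p₁, p₂, hp⟩ := hp
    obtain ⟨q₁, q₂, hq⟩ := hq
    refine ⟨p₁ + q₁, p₂ + q₂, fun x => ?_⟩
    simp only [eval_add, hp, hq]
    push_cast
    ring
  | monomial n a =>
    refine ⟨monomial n a.re, monomial n a.im, fun x => ?_⟩
    simp only [eval_monomial]
    push_cast
    nth_rw 1 [← Complex.re_add_im a]
    ring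

open Polynomial in
/-- If `p ≤ 1 / (1 + x ^ 2)` pointwise, then some polynomials are as close to the real and imaginary
parts of `1 / (x - i)` in the mean square as `p` is to `1 / (1 + x ^ 2)` in the mean. -/
lemma exists_polynomial_sq_le (p : ℝ[X]) (hp : ∀ x, p.eval x ≤ (1 + x ^ 2)⁻¹) :
    ∃ s₁ s₂ : ℝ[X], ∀ x : ℝ, (x * (1 + x ^ 2)⁻¹ - s₁.eval x) ^ 2 +
      ((1 + x ^ 2)⁻¹ - s₂.eval x) ^ 2 ≤ (1 + x ^ 2)⁻¹ - p.eval x := by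
  obtain ⟨r, hr1, hr2⟩ := exists_normSq_eq_of_nonneg (1 - p * (1 + X ^ 2)) fun x => by
    have h0 : (0 : ℝ) < 1 + x ^ 2 := by positivity
    have := mul_le_mul_of_nonneg_right (hp x) h0.le
    rw [inv_mul_cancel₀ h0.ne'] at this
    simpa using this
  simp only [map_sub, map_one, map_mul, map_add, map_pow, aeval_X, Complex.I_sq, add_neg_cancel,
    mul_zero, sub_zero, norm_one] at hr2
  have hne : r.eval Complex.I ≠ 0 := by
    intro h
    rw [h] at hr2
    norm_num at hr2
  -- The quotient of `1 - r / r(i)`, which vanishes at `i`, by `x - i`.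
  obtain ⟨s, hs⟩ : X - C Complex.I ∣ 1 - C (r.eval Complex.I)⁻¹ * r := by
    rw [dvd_iff_isRoot]
    simp [hne]
  obtain ⟨s₁, s₂, h12⟩ := exists_real_im_polynomial s
  refine ⟨s₁, s₂, fun x => ?_⟩
  have h0 : (0 : ℝ) < 1 + x ^ 2 := by positivity
  have hx0 : (x : ℂ) - Complex.I ≠ 0 := by
    intro h
    simpa using congrArg Complex.im h
  have hxn : ‖(x : ℂ) - Complex.I‖ ^ 2 = 1 + x ^ 2 := by
    rw [Complex.sq_norm, Complex.normSq_apply]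
    simp
    ring
  have hsx := congrArg (fun q : ℂ[X] => q.eval (x : ℂ)) hs
  simp only [eval_sub, eval_one, eval_mul, eval_C, eval_X] at hsx
  have h1 : ((x : ℂ) - Complex.I)⁻¹ =
      (x * (1 + x ^ 2)⁻¹ : ℝ) + ((1 + x ^ 2)⁻¹ : ℝ) * Complex.I := by
    have : ((1 + x ^ 2 : ℝ) : ℂ) = (x - Complex.I) * (x + Complex.I) := by
      push_cast
      linear_combination Complex.I_sq
    have h2 : (x : ℂ) + Complex.I ≠ 0 := by
      intro h
      simpa using congrArg Complex.im h
    rw [Complex.ofReal_mul, Complex.ofReal_inv, this]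
    field_simp
  have h2 : ((x * (1 + x ^ 2)⁻¹ - s₁.eval x : ℝ) : ℂ) +
      (((1 + x ^ 2)⁻¹ - s₂.eval x : ℝ) : ℂ) * Complex.I =
      (r.eval Complex.I)⁻¹ * r.eval (x : ℂ) * ((x : ℂ) - Complex.I)⁻¹ := by
    have h3 : s.eval (x : ℂ) =
        ((x : ℂ) - Complex.I)⁻¹ - (r.eval Complex.I)⁻¹ * r.eval (x : ℂ) *
          ((x : ℂ) - Complex.I)⁻¹ := by
      field_simp at hsx ⊢
      linear_combination -hsx
    rw [h12, h1] at h3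
    rw [h1]
    push_cast at h3 ⊢
    linear_combination -h3
  have h3 := congrArg (fun z : ℂ => ‖z‖ ^ 2) h2
  rw [Complex.sq_norm, Complex.normSq_add_mul_I, norm_mul, norm_mul, norm_inv, norm_inv, mul_pow,
    mul_pow, inv_pow, inv_pow, hxn, hr1] at h3
  rw [h3]
  have hq : (1 - p * (1 + X ^ 2) : ℝ[X]).eval x * (1 + x ^ 2)⁻¹ = (1 + x ^ 2)⁻¹ - p.eval x := by
    simp
    field_simp
  rw [mul_assoc, hq]
  exact mul_le_of_le_one_left (sub_nonneg.2 (hp x)) (inv_le_one_of_one_le₀ hr2)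

lemma memLp_two_eval {μ : Measure ℝ} (hμ : ∀ n : ℕ, Integrable (fun x : ℝ => x ^ n) μ)
    (p : Polynomial ℝ) : MemLp (fun x => p.eval x) 2 μ := by
  rw [memLp_two_iff_integrable_sq (by fun_prop)]
  exact (integrable_eval_of_pow hμ (p ^ 2)).congr (ae_of_all _ fun x => by simp)

lemma abs_integral_mul_le_sqrt {α : Type*} [MeasurableSpace α] {μ : Measure α} {f g : α → ℝ}
    (hf : MemLp f 2 μ) (hg : MemLp g 2 μ) :
    |∫ x, f x * g x ∂μ| ≤ √(∫ x, f x ^ 2 ∂μ) * √(∫ x, g x ^ 2 ∂μ) := by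
  have h := abs_real_inner_le_norm (hf.toLp f) (hg.toLp g)
  have e : ∀ {u v : α → ℝ} (hu : MemLp u 2 μ) (hv : MemLp v 2 μ),
      inner ℝ (hu.toLp u) (hv.toLp v) = ∫ x, u x * v x ∂μ := by
    intro u v hu hv
    rw [L2.inner_def]
    refine integral_congr_ae ?_
    filter_upwards [hu.coeFn_toLp, hv.coeFn_toLp] with x h1 h2
    rw [h1, h2, real_inner_eq_re_inner, RCLike.inner_apply]
    simp [mul_comm]
  have n : ∀ {u : α → ℝ} (hu : MemLp u 2 μ), ‖hu.toLp u‖ = √(∫ x, u x ^ 2 ∂μ) := by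
    intro u hu
    rw [norm_eq_sqrt_real_inner, e hu hu]
    simp only [sq]
  rwa [e, n, n] at h

/-- A function in `L²(μ)`, for a determinate `μ`, that is orthogonal to all polynomials vanishes.
The multiples `u` such that `g u` is still orthogonal to the polynomials form a space that is stable
under multiplication by the real and imaginary parts of `1 / (x - i)`, so they include a separating
algebra of bounded continuous functions. -/
lemma IdentifiableByMoments.ae_eq_zero_of_orthogonal {μ : Measure ℝ} [IsProbabilityMeasure μ]
    (hμ : IdentifiableByMoments μ) {g : ℝ → ℝ} (hg : MemLp g 2 μ)
    (horth : ∀ p : Polynomial ℝ, ∫ x, p.eval x * g x ∂μ = 0) : g =ᵐ[μ] 0 := by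
  have hbint : Integrable (fun x : ℝ => (1 + x ^ 2)⁻¹) μ :=
    integrable_of_mem_polyGrowth hμ.1 inv_one_add_sq_mem_polyGrowth
  have hcb : Continuous fun x : ℝ => (1 + x ^ 2)⁻¹ :=
    Continuous.inv₀ (by fun_prop) fun x => by positivity
  have hb1 : ∀ x : ℝ, |(1 + x ^ 2)⁻¹| ≤ 1 := fun x => by
    rw [abs_of_nonneg (by positivity)]
    exact inv_le_one_of_one_le₀ (by nlinarith [sq_nonneg x])
  have ha1 : ∀ x : ℝ, |x * (1 + x ^ 2)⁻¹| ≤ 1 := fun x => by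
    rw [abs_mul, abs_of_nonneg (by positivity : (0 : ℝ) ≤ (1 + x ^ 2)⁻¹), ← div_eq_mul_inv,
      div_le_one (by positivity)]
    nlinarith [sq_abs x, sq_nonneg (|x| - 1)]
  let b : BoundedContinuousFunction ℝ ℝ :=
    BoundedContinuousFunction.ofNormedAddCommGroup _ hcb 1 hb1
  let a : BoundedContinuousFunction ℝ ℝ :=
    BoundedContinuousFunction.ofNormedAddCommGroup _ (continuous_id.mul hcb) 1 ha1
  have hug : ∀ u : BoundedContinuousFunction ℝ ℝ, MemLp (fun x => u x * g x) 2 μ := fun u =>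
    hg.of_le_mul (c := ‖u‖) (u.continuous.aestronglyMeasurable.mul hg.1) (ae_of_all _ fun x => by
      rw [norm_mul]
      exact mul_le_mul_of_nonneg_right (u.norm_coe_le_norm x) (norm_nonneg _))
  have hpug : ∀ (p : Polynomial ℝ) (u : BoundedContinuousFunction ℝ ℝ),
      Integrable (fun x => p.eval x * (u x * g x)) μ := fun p u =>
    (memLp_two_eval hμ.1 p).integrable_mul (hug u)
  let N : Set (BoundedContinuousFunction ℝ ℝ) :=
    {u | ∀ p : Polynomial ℝ, ∫ x, p.eval x * (u x * g x) ∂μ = 0}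
  have hbd : ∀ u : BoundedContinuousFunction ℝ ℝ, MemLp u 2 μ := fun u =>
    MemLp.of_bound u.continuous.aestronglyMeasurable ‖u‖
      (ae_of_all _ fun x => u.norm_coe_le_norm x)
  have hvug : ∀ v u : BoundedContinuousFunction ℝ ℝ, Integrable (fun x => v x * (u x * g x)) μ :=
    fun v u => (hbd v).integrable_mul (hug u)
  -- `a` and `b` are limits in `L²(μ)` of polynomials.
  have hlim : ∀ u ∈ N, ∫ x, a x * (u x * g x) ∂μ = 0 ∧ ∫ x, b x * (u x * g x) ∂μ = 0 := by
    intro u hu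
    have hsmall : ∀ ε : ℝ, 0 < ε →
        |∫ x, a x * (u x * g x) ∂μ| ≤ √ε * √(∫ x, (u x * g x) ^ 2 ∂μ) ∧
        |∫ x, b x * (u x * g x) ∂μ| ≤ √ε * √(∫ x, (u x * g x) ^ 2 ∂μ) := by
      intro ε hε
      obtain ⟨p, hp, hpε⟩ := hμ.exists_polynomial_le hε
      obtain ⟨s₁, s₂, hs⟩ := exists_polynomial_sq_le p hp
      have hI : ∫ x, ((1 + x ^ 2)⁻¹ - p.eval x) ∂μ ≤ ε := by
        rw [integral_sub hbint (integrable_eval_of_pow hμ.1 p)]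
        linarith
      have aux : ∀ (v : BoundedContinuousFunction ℝ ℝ) (s : Polynomial ℝ),
          (∀ x, (v x - s.eval x) ^ 2 ≤ (1 + x ^ 2)⁻¹ - p.eval x) →
          |∫ x, v x * (u x * g x) ∂μ| ≤ √ε * √(∫ x, (u x * g x) ^ 2 ∂μ) := by
        intro v s hvs
        have h1 : ∫ x, v x * (u x * g x) ∂μ = ∫ x, (v x - s.eval x) * (u x * g x) ∂μ := by
          simp only [sub_mul]
          rw [integral_sub (hvug v u) (hpug s u), hu s, sub_zero]
        have h2 : MemLp (fun x => v x - s.eval x) 2 μ := (hbd v).sub (memLp_two_eval hμ.1 s)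
        rw [h1]
        refine (abs_integral_mul_le_sqrt h2 (hug u)).trans ?_
        gcongr
        exact (integral_mono h2.integrable_sq (hbint.sub (integrable_eval_of_pow hμ.1 p))
          hvs).trans hI
      refine ⟨aux a s₁ fun x => ?_, aux b s₂ fun x => ?_⟩
      · have := hs x
        change (x * (1 + x ^ 2)⁻¹ - s₁.eval x) ^ 2 ≤ _
        nlinarith [sq_nonneg ((1 + x ^ 2)⁻¹ - s₂.eval x)]
      · have := hs x
        change ((1 + x ^ 2)⁻¹ - s₂.eval x) ^ 2 ≤ _
        nlinarith [sq_nonneg (x * (1 + x ^ 2)⁻¹ - s₁.eval x)]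
    have hzero : ∀ c D : ℝ, (∀ ε : ℝ, 0 < ε → |c| ≤ √ε * D) → c = 0 := by
      intro c D h
      have ht : Tendsto (fun ε : ℝ => √ε * D) (𝓝[>] 0) (𝓝 (√0 * D)) :=
        ((Real.continuous_sqrt.tendsto 0).mul_const D).mono_left nhdsWithin_le_nhds
      rw [Real.sqrt_zero, zero_mul] at ht
      refine abs_eq_zero.1 (le_antisymm (ge_of_tendsto ht ?_) (abs_nonneg c))
      filter_upwards [self_mem_nhdsWithin] with ε hε using h ε hε
    exact ⟨hzero _ _ fun ε hε => (hsmall ε hε).1, hzero _ _ fun ε hε => (hsmall ε hε).2⟩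
  -- Division with remainder by `1 + x ^ 2`.
  have hdiv : ∀ p : Polynomial ℝ, ∃ (q : Polynomial ℝ) (c d : ℝ), ∀ x,
      p.eval x = q.eval x * (1 + x ^ 2) + (c * x + d) := by
    intro p
    have hm : (Polynomial.X ^ 2 + 1 : Polynomial ℝ).Monic := by monicity!
    have hd : (Polynomial.X ^ 2 + 1 : Polynomial ℝ).natDegree = 2 := by compute_degree!
    have hlt : (p %ₘ (Polynomial.X ^ 2 + 1)).natDegree < 2 := by
      have := Polynomial.natDegree_modByMonic_lt p hm fun h => by simp [h] at hd
      rwa [hd] at this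
    refine ⟨p /ₘ (Polynomial.X ^ 2 + 1), (p %ₘ (Polynomial.X ^ 2 + 1)).coeff 1,
      (p %ₘ (Polynomial.X ^ 2 + 1)).coeff 0, fun x => ?_⟩
    have h1 := congrArg (Polynomial.eval x)
      (Polynomial.modByMonic_add_div p (Polynomial.X ^ 2 + 1))
    have h2 : (p %ₘ (Polynomial.X ^ 2 + 1)).eval x =
        (p %ₘ (Polynomial.X ^ 2 + 1)).coeff 1 * x + (p %ₘ (Polynomial.X ^ 2 + 1)).coeff 0 := by
      rw [Polynomial.eval_eq_sum_range' hlt]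
      simp [Finset.sum_range_succ]
      ring
    rw [← h1, Polynomial.eval_add, h2]
    simp
    ring
  have hcomb : ∀ (u : BoundedContinuousFunction ℝ ℝ), u ∈ N → ∀ (v : ℝ → ℝ) (q : Polynomial ℝ)
      (c d : ℝ), (∀ x, v x = q.eval x + c * a x + d * b x) →
      ∫ x, v x * (u x * g x) ∂μ = 0 := by
    intro u hu v q c d hv
    simp only [hv, add_mul, mul_assoc]
    have ia := (hvug a u).const_mul c
    have ib := (hvug b u).const_mul d
    rw [integral_add (by exact (hpug q u).add ia) ib, integral_add (hpug q u) ia,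
      integral_const_mul, integral_const_mul, hu q, (hlim u hu).1, (hlim u hu).2]
    ring
  have haN : ∀ u ∈ N, a * u ∈ N := by
    intro u hu p
    obtain ⟨q, c, d, hq⟩ := hdiv p
    have := hcomb u hu (fun x => p.eval x * a x) (q * Polynomial.X + Polynomial.C c) d (-c)
      fun x => by
        have h0 : (1 + x ^ 2 : ℝ) ≠ 0 := by positivity
        change p.eval x * (x * (1 + x ^ 2)⁻¹) = _ + d * (x * (1 + x ^ 2)⁻¹) +
          -c * (1 + x ^ 2)⁻¹
        rw [hq]
        simp
        field_simp
        ring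
    rw [← this]
    refine integral_congr_ae (ae_of_all _ fun x => ?_)
    simp only [BoundedContinuousFunction.coe_mul, Pi.mul_apply]
    ring
  have hbN : ∀ u ∈ N, b * u ∈ N := by
    intro u hu p
    obtain ⟨q, c, d, hq⟩ := hdiv p
    have := hcomb u hu (fun x => p.eval x * b x) q c d
      fun x => by
        have h0 : (1 + x ^ 2 : ℝ) ≠ 0 := by positivity
        change p.eval x * (1 + x ^ 2)⁻¹ = _ + c * (x * (1 + x ^ 2)⁻¹) + d * (1 + x ^ 2)⁻¹
        rw [hq]
        field_simp
        ring
    rw [← this]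
    refine integral_congr_ae (ae_of_all _ fun x => ?_)
    simp only [BoundedContinuousFunction.coe_mul, Pi.mul_apply]
    ring
  have h1N : (1 : BoundedContinuousFunction ℝ ℝ) ∈ N := fun p => by simpa using horth p
  let A : StarSubalgebra ℝ (BoundedContinuousFunction ℝ ℝ) :=
    { carrier := {v | ∀ u ∈ N, v * u ∈ N}
      mul_mem' := fun {v w} hv hw u hu => by
        rw [mul_assoc]
        exact hv _ (hw u hu)
      add_mem' := fun {v w} hv hw u hu p => by
        have h := integral_add (hpug p (v * u)) (hpug p (w * u))
        rw [hv u hu p, hw u hu p, add_zero] at h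
        rw [← h]
        refine integral_congr_ae (ae_of_all _ fun x => ?_)
        simp only [BoundedContinuousFunction.coe_mul, BoundedContinuousFunction.coe_add,
          Pi.mul_apply, Pi.add_apply]
        ring
      algebraMap_mem' := fun c u hu p => by
        have h := integral_const_mul (μ := μ) c fun x => p.eval x * (u x * g x)
        rw [hu p, mul_zero] at h
        rw [← h]
        refine integral_congr_ae (ae_of_all _ fun x => ?_)
        simp only [BoundedContinuousFunction.coe_mul, Pi.mul_apply,
          BoundedContinuousFunction.algebraMap_apply, smul_eq_mul, mul_one]
        ring
      star_mem' := fun {v} hv => by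
        have : star v = v := by ext x; simp
        rwa [this] }
  have hgi : Integrable g μ := by simpa using hpug 1 1
  have hfin : ∀ {f : ℝ → ℝ}, Integrable f μ →
      IsFiniteMeasure (μ.withDensity fun x => ENNReal.ofReal (f x)) := fun hf =>
    isFiniteMeasure_withDensity_ofReal hf.2
  have := hfin hgi
  have := hfin hgi.neg
  have hmeas : μ.withDensity (fun x => ENNReal.ofReal (g x)) =
      μ.withDensity fun x => ENNReal.ofReal ((-g) x) := by
    refine ext_of_forall_mem_subalgebra_integral_eq_of_polish (𝕜 := ℝ) (A := A) ?_ ?_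
    · intro x y hxy
      have memA : ∀ v : BoundedContinuousFunction ℝ ℝ, v ∈ A → v x ≠ v y →
          ∃ f ∈ (fun f : C(ℝ, ℝ) => (f : ℝ → ℝ)) ''
            (A.map (BoundedContinuousFunction.toContinuousMapStarₐ ℝ) : Set C(ℝ, ℝ)),
            f x ≠ f y := fun v hv hne =>
        ⟨v, ⟨_, ⟨v, hv, rfl⟩, rfl⟩, hne⟩
      by_cases hb : b x = b y
      · refine memA a haN fun ha => hxy ?_
        change x * (1 + x ^ 2)⁻¹ = y * (1 + y ^ 2)⁻¹ at ha
        change (1 + x ^ 2)⁻¹ = (1 + y ^ 2)⁻¹ at hb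
        rw [hb] at ha
        exact mul_right_cancel₀ (by positivity) ha
      · exact memA b hbN hb
    · intro v hv
      have hv0 : ∫ x, v x * g x ∂μ = 0 := by
        have := hv 1 h1N 1
        simpa using this
      have hae : ∀ {f : ℝ → ℝ}, AEMeasurable f μ →
          ∫ x, v x ∂(μ.withDensity fun x => ENNReal.ofReal (f x)) =
          ∫ x, max (f x) 0 * v x ∂μ := by
        intro f hf
        rw [integral_withDensity_eq_integral_toReal_smul₀ hf.ennreal_ofReal
          (ae_of_all _ fun x => ENNReal.ofReal_lt_top)]
        simp [ENNReal.toReal_ofReal']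
      rw [hae hgi.aemeasurable, hae hgi.neg.aemeasurable, ← sub_eq_zero,
        ← integral_sub]
      · refine Eq.trans ?_ hv0
        refine integral_congr_ae (ae_of_all _ fun x => ?_)
        simp only [Pi.neg_apply]
        rcases le_total (g x) 0 with h | h
        · rw [max_eq_right h, max_eq_left (by linarith)]; ring
        · rw [max_eq_left h, max_eq_right (by linarith)]; ring
      · exact hgi.pos_part.mul_bdd v.continuous.aestronglyMeasurable
          (ae_of_all _ fun x => v.norm_coe_le_norm x)
      · exact hgi.neg.pos_part.mul_bdd v.continuous.aestronglyMeasurable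
          (ae_of_all _ fun x => v.norm_coe_le_norm x)
  rw [withDensity_eq_iff hgi.aemeasurable.ennreal_ofReal hgi.neg.aemeasurable.ennreal_ofReal
    (hgi.lintegral_lt_top).ne] at hmeas
  filter_upwards [hmeas] with x hx
  rw [Pi.neg_apply] at hx
  rcases le_total (g x) 0 with h | h
  · rw [ENNReal.ofReal_of_nonpos h, eq_comm, ENNReal.ofReal_eq_zero] at hx
    have : 0 ≤ g x := by linarith
    exact le_antisymm h this
  · rw [ENNReal.ofReal_of_nonpos (by linarith : -g x ≤ 0), ENNReal.ofReal_eq_zero] at hx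
    exact le_antisymm hx h

/-! ### Orthonormal polynomials and the support -/

lemma supportSize_pos (μ : Measure ℝ) [IsProbabilityMeasure μ] : 0 < supportSize μ :=
  Set.encard_pos.2 (Measure.nonempty_support (IsProbabilityMeasure.ne_zero μ))

/-- A nonzero polynomial with fewer zeros than `μ` has support points does not vanish almost
everywhere. -/
lemma not_ae_eval_eq_zero {μ : Measure ℝ} {p : Polynomial ℝ} (hp : p ≠ 0)
    (hdeg : (p.natDegree : ℕ∞) < supportSize μ) : ¬ ∀ᵐ x ∂μ, p.eval x = 0 := by
  intro h
  have hsub : μ.support ⊆ (p.roots.toFinset : Set ℝ) := by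
    have := Measure.support_subset_of_isClosed
      (isClosed_eq p.continuous (continuous_const (y := (0 : ℝ)))) h
    intro x hx
    simpa [hp] using this hx
  have h1 : supportSize μ ≤ p.natDegree := by
    refine (Set.encard_le_encard hsub).trans ?_
    rw [Set.encard_coe_eq_coe_finsetCard]
    exact_mod_cast (Multiset.toFinset_card_le _).trans (Polynomial.card_roots' p)
  exact absurd hdeg (not_lt.2 h1)

/-- On the support of `μ` every polynomial agrees with one of degree less than the number of points
of the support. -/
lemma exists_natDegree_lt_supportSize (μ : Measure ℝ) [IsProbabilityMeasure μ]
    (p : Polynomial ℝ) : ∃ q : Polynomial ℝ, (q.natDegree : ℕ∞) < supportSize μ ∧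
      ∀ x ∈ μ.support, p.eval x = q.eval x := by
  by_cases hfin : μ.support.Finite
  · set S := hfin.toFinset with hS
    have hcard : supportSize μ = S.card := hfin.encard_eq_coe_toFinset_card
    let m : Polynomial ℝ := ∏ a ∈ S, (Polynomial.X - Polynomial.C a)
    have hm : m.Monic := Polynomial.monic_prod_of_monic _ _ fun a _ => Polynomial.monic_X_sub_C a
    have hmd : m.natDegree = S.card := Polynomial.natDegree_finsetProd_X_sub_C_eq_card S id
    have hpos : 0 < S.card := by
      have := supportSize_pos μ
      rw [hcard] at this
      exact_mod_cast this
    refine ⟨p %ₘ m, ?_, fun x hx => ?_⟩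
    · rw [hcard, ← hmd]
      exact_mod_cast Polynomial.natDegree_modByMonic_lt p hm fun h => by
        rw [h, Polynomial.natDegree_one] at hmd
        omega
    · have h0 : m.eval x = 0 := by
        rw [Polynomial.eval_prod]
        exact Finset.prod_eq_zero (hfin.mem_toFinset.2 hx) (by simp)
      conv_lhs => rw [← Polynomial.modByMonic_add_div p m]
      simp [h0]
  · refine ⟨p, ?_, fun x _ => rfl⟩
    rw [supportSize, Set.encard_eq_top hfin]
    exact ENat.natCast_lt_top _

/-- Polynomials `h n` of degree `n`, for `n < ν`, span the polynomials of degree less than `ν`. -/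
lemma mem_span_of_natDegree_lt {ν : ℕ∞} {h : ℕ → Polynomial ℝ}
    (hdeg : ∀ n : ℕ, (n : ℕ∞) < ν → (h n).natDegree = n ∧ h n ≠ 0) (p : Polynomial ℝ)
    (hp : (p.natDegree : ℕ∞) < ν) :
    p ∈ Submodule.span ℝ (Set.range fun n : {n : ℕ // (n : ℕ∞) < ν} => h n) := by
  induction hn : p.natDegree using Nat.strong_induction_on generalizing p with
  | _ n ih =>
  rw [hn] at hp
  obtain ⟨hd, hne⟩ := hdeg n hp
  have hmem : h n ∈ Submodule.span ℝ (Set.range fun n : {n : ℕ // (n : ℕ∞) < ν} => h n) :=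
    Submodule.subset_span ⟨⟨n, hp⟩, rfl⟩
  set c := p.leadingCoeff / (h n).leadingCoeff
  rw [← sub_add_cancel p (c • h n)]
  refine Submodule.add_mem _ ?_ (Submodule.smul_mem _ _ hmem)
  by_cases hp0 : p = 0
  · simp [hp0, c]
  have hc : c ≠ 0 := div_ne_zero (by simpa using hp0) (by simpa using hne)
  have hlt : (p - c • h n).degree < p.degree := by
    refine Polynomial.degree_sub_lt_left ?_ hp0 ?_
    · rw [Polynomial.degree_smul_of_smul_regular _ (IsSMulRegular.of_ne_zero hc)]
      rw [Polynomial.degree_eq_natDegree hp0, Polynomial.degree_eq_natDegree hne, hn, hd]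
    · rw [Polynomial.smul_eq_C_mul, Polynomial.leadingCoeff_mul, Polynomial.leadingCoeff_C,
        div_mul_cancel₀ _ (by simpa using hne)]
  by_cases h0 : p - c • h n = 0
  · rw [h0]; exact Submodule.zero_mem _
  have hlt' : (p - c • h n).natDegree < n := (Polynomial.natDegree_lt_natDegree h0 hlt).trans_eq hn
  exact ih _ hlt' _ ((Nat.cast_lt.2 hlt').trans hp) rfl

/-- The class in `L²(μ)` of a polynomial function. -/
noncomputable def evalLp {μ : Measure ℝ} (hμ : ∀ n : ℕ, Integrable (fun x : ℝ => x ^ n) μ)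
    (p : Polynomial ℝ) : Lp ℝ 2 μ :=
  (memLp_two_eval hμ p).toLp _

lemma coeFn_evalLp {μ : Measure ℝ} (hμ : ∀ n : ℕ, Integrable (fun x : ℝ => x ^ n) μ)
    (p : Polynomial ℝ) : (evalLp hμ p : ℝ → ℝ) =ᵐ[μ] fun x => p.eval x :=
  (memLp_two_eval hμ p).coeFn_toLp

lemma inner_evalLp {μ : Measure ℝ} (hμ : ∀ n : ℕ, Integrable (fun x : ℝ => x ^ n) μ)
    (p : Polynomial ℝ) (f : Lp ℝ 2 μ) : inner ℝ (evalLp hμ p) f = ∫ x, p.eval x * f x ∂μ := by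
  rw [L2.inner_def]
  refine integral_congr_ae ?_
  filter_upwards [coeFn_evalLp hμ p] with x hx
  rw [hx, real_inner_eq_re_inner, RCLike.inner_apply]
  simp [mul_comm]

/-- Polynomials `h n` of degree `n` that are orthonormal with respect to `μ`. -/
structure IsOrthonormalSystem (μ : Measure ℝ) (h : ℕ → Polynomial ℝ) : Prop where
  natDegree_eq : ∀ n : Idx μ, (h n).natDegree = n
  orthonormal : ∀ m n : Idx μ, ∫ x, (h m).eval x * (h n).eval x ∂μ = if m = n then 1 else 0

namespace IsOrthonormalSystem

variable {μ : Measure ℝ} {h : ℕ → Polynomial ℝ}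

lemma ne_zero (hh : IsOrthonormalSystem μ h) (n : Idx μ) : h n ≠ 0 := by
  intro h0
  simpa [h0] using hh.orthonormal n n

lemma mem_span (hh : IsOrthonormalSystem μ h) {p : Polynomial ℝ}
    (hp : (p.natDegree : ℕ∞) < supportSize μ) :
    p ∈ Submodule.span ℝ (Set.range fun n : Idx μ => h n) :=
  mem_span_of_natDegree_lt (fun n hn => ⟨hh.natDegree_eq ⟨n, hn⟩, hh.ne_zero ⟨n, hn⟩⟩) p hp

lemma orthonormal_evalLp (hh : IsOrthonormalSystem μ h)
    (hμ : ∀ n : ℕ, Integrable (fun x : ℝ => x ^ n) μ) :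
    Orthonormal ℝ fun n : Idx μ => evalLp hμ (h n) := by
  classical
  rw [orthonormal_iff_ite]
  intro m n
  rw [inner_evalLp, ← hh.orthonormal m n]
  refine integral_congr_ae ?_
  filter_upwards [coeFn_evalLp hμ (h n)] with x hx
  rw [hx]

lemma orthogonal_span_eq_bot [IsProbabilityMeasure μ] (hh : IsOrthonormalSystem μ h)
    (hμ : IdentifiableByMoments μ) :
    (Submodule.span ℝ (Set.range fun n : Idx μ => evalLp hμ.1 (h n)))ᗮ = ⊥ := by
  rw [Submodule.eq_bot_iff]
  intro g hg
  rw [Lp.eq_zero_iff_ae_eq_zero]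
  refine hμ.ae_eq_zero_of_orthogonal (Lp.memLp g) fun p => ?_
  obtain ⟨q, hq, hpq⟩ := exists_natDegree_lt_supportSize μ p
  have h1 : ∫ x, p.eval x * g x ∂μ = ∫ x, q.eval x * g x ∂μ := by
    refine integral_congr_ae ?_
    filter_upwards [Measure.support_mem_ae (μ := μ)] with x hx
    rw [hpq x hx]
  rw [h1]
  have hq' := hh.mem_span hq
  clear h1 hpq hq
  have hint : ∀ r : Polynomial ℝ, Integrable (fun x => r.eval x * g x) μ := fun r =>
    (memLp_two_eval hμ.1 r).integrable_mul (Lp.memLp g)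
  induction hq' using Submodule.span_induction with
  | mem r hr =>
    obtain ⟨n, rfl⟩ := hr
    rw [← inner_evalLp hμ.1]
    exact hg _ (Submodule.subset_span ⟨n, rfl⟩)
  | zero => simp
  | add r s _ _ hr hs =>
    simp only [Polynomial.eval_add, add_mul]
    rw [integral_add (hint r) (hint s), hr, hs, add_zero]
  | smul c r _ hr =>
    simp only [Polynomial.eval_smul, smul_eq_mul, mul_assoc]
    rw [integral_const_mul, hr, mul_zero]

/-- Orthonormal polynomials of all degrees below the size of the support form a Hilbert basis of
`L²(μ)` if `μ` is determined by its moments. -/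
noncomputable def hilbertBasis [IsProbabilityMeasure μ] (hh : IsOrthonormalSystem μ h)
    (hμ : IdentifiableByMoments μ) : HilbertBasis (Idx μ) ℝ (Lp ℝ 2 μ) :=
  HilbertBasis.mkOfOrthogonalEqBot (hh.orthonormal_evalLp hμ.1) (hh.orthogonal_span_eq_bot hμ)

lemma hilbertBasis_apply [IsProbabilityMeasure μ] (hh : IsOrthonormalSystem μ h)
    (hμ : IdentifiableByMoments μ) (n : Idx μ) : hh.hilbertBasis hμ n = evalLp hμ.1 (h n) :=
  congrFun (HilbertBasis.coe_mkOfOrthogonalEqBot _ _) n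

/-- If two laws determined by their moments have a common system of orthonormal polynomials, and
either both supports are infinite or the supports coincide, then the laws coincide: the
functionals on polynomials agree on the system, hence on polynomials of small degree, and on the
support every polynomial has small degree. -/
lemma measure_unique {μ' : Measure ℝ} [IsProbabilityMeasure μ] [IsProbabilityMeasure μ']
    (hh : IsOrthonormalSystem μ h) (hh' : IsOrthonormalSystem μ' h)
    (hμ : IdentifiableByMoments μ) (hμ' : IdentifiableByMoments μ')
    (hs : (supportSize μ = ⊤ ∧ supportSize μ' = ⊤) ∨ μ'.support = μ.support) : μ' = μ := by
  have hsize : supportSize μ' = supportSize μ := by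
    rcases hs with hs | hs
    · rw [hs.1, hs.2]
    · rw [supportSize, hs, supportSize]
  have h0 := supportSize_pos μ
  have hlow : ∀ q : Polynomial ℝ, (q.natDegree : ℕ∞) < supportSize μ →
      ∫ x, q.eval x ∂μ' = ∫ x, q.eval x ∂μ := by
    intro q hq
    have hq' := hh.mem_span hq
    clear hq
    induction hq' using Submodule.span_induction with
    | mem r hr =>
      obtain ⟨n, rfl⟩ := hr
      have hn' : ((n : ℕ) : ℕ∞) < supportSize μ' := hsize.symm ▸ n.2
      have e := hh.orthonormal ⟨0, h0⟩ n
      have e' := hh'.orthonormal ⟨0, hsize.symm ▸ h0⟩ ⟨n, hn'⟩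
      obtain ⟨c, hc⟩ : ∃ c, h 0 = Polynomial.C c :=
        ⟨_, Polynomial.eq_C_of_natDegree_eq_zero (hh.natDegree_eq ⟨0, h0⟩)⟩
      have hc0 : c ≠ 0 := by
        rintro rfl
        exact hh.ne_zero ⟨0, h0⟩ (by simpa using hc)
      simp only [hc, Polynomial.eval_C] at e e'
      rw [integral_const_mul] at e e'
      simp only [Subtype.ext_iff] at e e'
      exact mul_left_cancel₀ hc0 (e'.trans e.symm)
    | zero => simp
    | add r s _ _ hr hs =>
      simp only [Polynomial.eval_add]
      rw [integral_add (integrable_eval_of_pow hμ.1 r) (integrable_eval_of_pow hμ.1 s),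
        integral_add (integrable_eval_of_pow hμ'.1 r) (integrable_eval_of_pow hμ'.1 s), hr, hs]
    | smul c r _ hr =>
      simp only [Polynomial.eval_smul, smul_eq_mul]
      rw [integral_const_mul, integral_const_mul, hr]
  have hall : ∀ p : Polynomial ℝ, ∫ x, p.eval x ∂μ' = ∫ x, p.eval x ∂μ := by
    intro p
    rcases hs with hs | hs
    · exact hlow p (by rw [hs.1]; exact ENat.natCast_lt_top _)
    · obtain ⟨q, hq, hpq⟩ := exists_natDegree_lt_supportSize μ p
      have h1 : ∫ x, p.eval x ∂μ = ∫ x, q.eval x ∂μ := by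
        refine integral_congr_ae ?_
        filter_upwards [Measure.support_mem_ae (μ := μ)] with x hx using hpq x hx
      have h2 : ∫ x, p.eval x ∂μ' = ∫ x, q.eval x ∂μ' := by
        refine integral_congr_ae ?_
        filter_upwards [Measure.support_mem_ae (μ := μ')] with x hx using hpq x (hs ▸ hx)
      rw [h1, h2, hlow q hq]
  exact hμ.2 μ' hμ'.1 fun n => by simpa using hall (Polynomial.X ^ n)

end IsOrthonormalSystem

/-! ### Diagonal operators in a Hilbert basis -/

section Diagonal

variable {ι E : Type*} [NormedAddCommGroup E] [InnerProductSpace ℝ E]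

lemma hasSum_repr_sq (b : HilbertBasis ι ℝ E) (x : E) :
    HasSum (fun n => b.repr x n ^ 2) (‖x‖ ^ 2) := by
  have h := b.hasSum_inner_mul_inner x x
  rw [real_inner_self_eq_norm_sq] at h
  refine h.congr_fun fun n => ?_
  rw [b.repr_apply_apply, real_inner_comm, sq]

/-- The vector with a given square summable family of coordinates. -/
noncomputable def ofCoords (b : HilbertBasis ι ℝ E) (f : ι → ℝ) (hf : Summable fun n => f n ^ 2) :
    E :=
  b.repr.symm ⟨f, memℓp_gen <| by simpa using hf⟩

lemma repr_ofCoords (b : HilbertBasis ι ℝ E) (f : ι → ℝ) (hf : Summable fun n => f n ^ 2) (n : ι) :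
    b.repr (ofCoords b f hf) n = f n := by
  rw [ofCoords, LinearIsometryEquiv.apply_symm_apply]

lemma ext_repr (b : HilbertBasis ι ℝ E) {x y : E} (h : ∀ n, b.repr x n = b.repr y n) : x = y :=
  b.repr.injective <| lp.ext <| funext h

lemma continuous_repr (b : HilbertBasis ι ℝ E) (n : ι) : Continuous fun x => b.repr x n := by
  simp only [b.repr_apply_apply]
  fun_prop

/-- Coordinatewise convergence with square summable domination implies convergence in norm. -/
lemma tendsto_of_tendsto_repr (b : HilbertBasis ι ℝ E) {T : Type*} {l : Filter T} {F : T → E}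
    {g : E} {G : ι → ℝ} (hG : Summable fun n => G n ^ 2)
    (hF : ∀ᶠ t in l, ∀ n, |b.repr (F t) n - b.repr g n| ≤ G n)
    (hlim : ∀ n, Tendsto (fun t => b.repr (F t) n) l (𝓝 (b.repr g n))) :
    Tendsto F l (𝓝 g) := by
  have h1 : Tendsto (fun t => ∑' n, b.repr (F t - g) n ^ 2) l (𝓝 (∑' _ : ι, (0 : ℝ))) := by
    refine tendsto_tsum_of_dominated_convergence hG (fun n => ?_) ?_
    · have := ((hlim n).sub_const (b.repr g n)).pow 2
      simpa [map_sub] using this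
    · filter_upwards [hF] with t ht n
      rw [Real.norm_of_nonneg (sq_nonneg _), ← sq_abs]
      simpa [map_sub] using pow_le_pow_left₀ (abs_nonneg _) (ht n) 2
  simp only [(hasSum_repr_sq b _).tsum_eq, tsum_zero] at h1
  rw [tendsto_iff_norm_sub_tendsto_zero]
  simpa using h1.sqrt

lemma summable_mul_repr_sq (b : HilbertBasis ι ℝ E) (c : ι → ℝ) (hc : ∀ n, |c n| ≤ 1) (x : E) :
    Summable fun n => (c n * b.repr x n) ^ 2 :=
  (hasSum_repr_sq b x).summable.of_nonneg_of_le (fun n => sq_nonneg _) fun n => by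
    rw [mul_pow, ← sq_abs (c n)]
    exact mul_le_of_le_one_left (sq_nonneg _) (pow_le_one₀ (abs_nonneg _) (hc n))

/-- The operator that multiplies the `n`-th coordinate by `c n`, where `|c n| ≤ 1`. -/
noncomputable def diagonalOperator (b : HilbertBasis ι ℝ E) (c : ι → ℝ) (hc : ∀ n, |c n| ≤ 1) :
    E →L[ℝ] E :=
  LinearMap.mkContinuous
    { toFun := fun x => ofCoords b (fun n => c n * b.repr x n) (summable_mul_repr_sq b c hc x)
      map_add' := fun x y => ext_repr b fun n => by
        simp only [repr_ofCoords, map_add, lp.coeFn_add, Pi.add_apply, mul_add]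
      map_smul' := fun r x => ext_repr b fun n => by
        simp only [repr_ofCoords, map_smul, lp.coeFn_smul, Pi.smul_apply, smul_eq_mul,
          RingHom.id_apply]
        ring } 1
    fun x => by
      rw [one_mul]
      refine (abs_le_of_sq_le_sq' ?_ (norm_nonneg _)).2
      refine hasSum_le (fun n => ?_) (hasSum_repr_sq b _) (hasSum_repr_sq b x)
      simp only [LinearMap.coe_mk, AddHom.coe_mk]
      rw [repr_ofCoords, mul_pow, ← sq_abs (c n)]
      exact mul_le_of_le_one_left (sq_nonneg _) (pow_le_one₀ (abs_nonneg _) (hc n))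

lemma repr_diagonalOperator (b : HilbertBasis ι ℝ E) (c : ι → ℝ) (hc : ∀ n, |c n| ≤ 1) (x : E)
    (n : ι) : b.repr (diagonalOperator b c hc x) n = c n * b.repr x n :=
  repr_ofCoords b _ (summable_mul_repr_sq b c hc x) n

lemma abs_exp_neg_mul_le_one {a : ℝ} (ha : 0 ≤ a) (t : ℝ≥0) : |Real.exp (-(a * t))| ≤ 1 := by
  rw [Real.abs_exp, Real.exp_le_one_iff]
  have := t.2
  have := mul_nonneg ha this
  simpa using this

/-- The semigroup that multiplies the `n`-th coordinate by `exp (-α n t)`, where `α n ≥ 0`. -/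
noncomputable def diagonalSemigroup (b : HilbertBasis ι ℝ E) (α : ι → ℝ) (hα : ∀ n, 0 ≤ α n)
    (t : ℝ≥0) : E →L[ℝ] E :=
  diagonalOperator b (fun n => Real.exp (-(α n * t))) fun n => abs_exp_neg_mul_le_one (hα n) t

variable (b : HilbertBasis ι ℝ E) (α : ι → ℝ) (hα : ∀ n, 0 ≤ α n)

lemma repr_diagonalSemigroup (t : ℝ≥0) (x : E) (n : ι) :
    b.repr (diagonalSemigroup b α hα t x) n = Real.exp (-(α n * t)) * b.repr x n :=
  repr_diagonalOperator _ _ _ _ _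

lemma hasSum_diagonalSemigroup (t : ℝ≥0) (x : E) :
    HasSum (fun n => (Real.exp (-(α n * t)) * b.repr x n) • b n)
      (diagonalSemigroup b α hα t x) := by
  simpa only [repr_diagonalSemigroup] using b.hasSum_repr (diagonalSemigroup b α hα t x)

lemma diagonalSemigroup_basis (t : ℝ≥0) (n : ι) :
    diagonalSemigroup b α hα t (b n) = Real.exp (-(α n * t)) • b n := by
  classical
  refine ext_repr b fun m => ?_
  rw [repr_diagonalSemigroup, map_smul, lp.coeFn_smul, Pi.smul_apply, smul_eq_mul, b.repr_self]
  by_cases h : m = n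
  · rw [h]
  · rw [lp.single_apply_ne _ _ _ h, mul_zero, mul_zero]

lemma isStronglyContinuousSemigroup_diagonalSemigroup :
    IsStronglyContinuousSemigroup (diagonalSemigroup b α hα) where
  map_zero := by
    ext x
    exact ext_repr b fun n => by simp [repr_diagonalSemigroup]
  map_add s t := by
    ext x
    refine ext_repr b fun n => ?_
    rw [ContinuousLinearMap.comp_apply, repr_diagonalSemigroup, repr_diagonalSemigroup,
      repr_diagonalSemigroup, ← mul_assoc, ← Real.exp_add]
    congr 2
    push_cast
    ring
  continuous f := by
    rw [continuous_iff_continuousAt]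
    intro t
    refine tendsto_of_tendsto_repr b (G := fun n => 2 * |b.repr f n|) ?_
      (Eventually.of_forall fun s n => ?_) fun n => ?_
    · simpa only [mul_pow, sq_abs] using (hasSum_repr_sq b f).summable.mul_left (2 ^ 2)
    · rw [repr_diagonalSemigroup, repr_diagonalSemigroup, ← sub_mul, abs_mul]
      refine mul_le_mul_of_nonneg_right ?_ (abs_nonneg _)
      refine (abs_sub _ _).trans ?_
      linarith [abs_exp_neg_mul_le_one (hα n) s, abs_exp_neg_mul_le_one (hα n) t]
    · simp only [repr_diagonalSemigroup]
      have : Continuous fun s : ℝ≥0 => Real.exp (-(α n * s)) * b.repr f n := by fun_prop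
      exact this.tendsto t

lemma summable_neg_mul_repr_sq {f : E} (hf : Summable fun n => b.repr f n ^ 2 * α n ^ 2) :
    Summable fun n => (-(α n * b.repr f n)) ^ 2 :=
  hf.congr fun n => by ring

/-- The diagonal operator `f ↦ -∑ α n c n b n` on its maximal domain. -/
noncomputable def diagonalGenerator (b : HilbertBasis ι ℝ E) (α : ι → ℝ) : E →ₗ.[ℝ] E where
  domain :=
    { carrier := {f | Summable fun n => b.repr f n ^ 2 * α n ^ 2}
      zero_mem' := by simp
      add_mem' := fun {f g} hf hg => by
        refine ((hf.mul_left 2).add (hg.mul_left 2)).of_nonneg_of_le (fun n => by positivity)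
          fun n => ?_
        simp only [map_add, lp.coeFn_add, Pi.add_apply]
        nlinarith [sq_nonneg ((b.repr f n - b.repr g n) * α n)]
      smul_mem' := fun c f hf => by
        refine (hf.mul_left (c ^ 2)).congr fun n => ?_
        simp only [map_smul, lp.coeFn_smul, Pi.smul_apply, smul_eq_mul]
        ring }
  toFun :=
    { toFun := fun f => ofCoords b (fun n => -(α n * b.repr (f : E) n))
        (summable_neg_mul_repr_sq b α f.2)
      map_add' := fun f g => ext_repr b fun n => by
        simp only [map_add, lp.coeFn_add, Pi.add_apply, repr_ofCoords, Submodule.coe_add]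
        ring
      map_smul' := fun c f => ext_repr b fun n => by
        simp only [map_smul, lp.coeFn_smul, Pi.smul_apply, smul_eq_mul, RingHom.id_apply,
          repr_ofCoords, Submodule.coe_smul]
        ring }

lemma mem_domain_diagonalGenerator (f : E) :
    f ∈ (diagonalGenerator b α).domain ↔ Summable fun n => b.repr f n ^ 2 * α n ^ 2 := Iff.rfl

lemma repr_diagonalGenerator (f : (diagonalGenerator b α).domain) (n : ι) :
    b.repr (diagonalGenerator b α f) n = -(α n * b.repr (f : E) n) :=
  repr_ofCoords b _ (summable_neg_mul_repr_sq b α f.2) n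

lemma hasSum_diagonalGenerator (f : (diagonalGenerator b α).domain) :
    HasSum (fun n => -(α n * b.repr (f : E) n) • b n) (diagonalGenerator b α f) := by
  have := b.hasSum_repr (diagonalGenerator b α f)
  simp only [repr_diagonalGenerator] at this
  exact this

lemma tendsto_inv_mul_exp_sub_one (a : ℝ) :
    Tendsto (fun t : ℝ≥0 => (t : ℝ)⁻¹ * (Real.exp (-(a * t)) - 1)) (𝓝[>] 0) (𝓝 (-a)) := by
  have h1 : HasDerivAt (fun t : ℝ => Real.exp (-(a * t))) (-a) 0 := by
    have := (((hasDerivAt_id (0 : ℝ)).const_mul a).neg).exp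
    simpa using this
  have h2 := h1.tendsto_slope_zero
  have h3 : Tendsto (fun t : ℝ≥0 => (t : ℝ)) (𝓝[>] 0) (𝓝[≠] 0) := by
    refine tendsto_nhdsWithin_iff.2 ⟨?_, ?_⟩
    · exact (NNReal.continuous_coe.tendsto 0).mono_left nhdsWithin_le_nhds
    · filter_upwards [self_mem_nhdsWithin] with t ht
      have : (0 : ℝ) < t := ht
      exact this.ne'
  refine (h2.comp h3).congr fun t => ?_
  simp

lemma tendsto_repr_diff_quotient (f : E) (n : ι) :
    Tendsto (fun t : ℝ≥0 => b.repr ((t : ℝ)⁻¹ • (diagonalSemigroup b α hα t f - f)) n)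
      (𝓝[>] 0) (𝓝 (-(α n * b.repr f n))) := by
  have h := (tendsto_inv_mul_exp_sub_one (α n)).mul_const (b.repr f n)
  rw [neg_mul] at h
  refine h.congr fun t => ?_
  simp only [map_smul, map_sub, lp.coeFn_smul, lp.coeFn_sub, Pi.smul_apply, Pi.sub_apply,
    smul_eq_mul, repr_diagonalSemigroup]
  ring

lemma isInfinitesimalGenerator_diagonalGenerator :
    IsInfinitesimalGenerator (diagonalSemigroup b α hα) (diagonalGenerator b α) := by
  have key : ∀ f : (diagonalGenerator b α).domain,
      Tendsto (fun t : ℝ≥0 => (t : ℝ)⁻¹ • (diagonalSemigroup b α hα t (f : E) - (f : E)))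
        (𝓝[>] 0) (𝓝 (diagonalGenerator b α f)) := by
    intro f
    refine tendsto_of_tendsto_repr b (G := fun n => 2 * |α n * b.repr (f : E) n|) ?_ ?_ fun n => ?_
    · refine (((mem_domain_diagonalGenerator b α _).1 f.2).mul_left (2 ^ 2)).congr fun n => ?_
      rw [mul_pow, sq_abs]
      ring
    · filter_upwards [self_mem_nhdsWithin] with t ht n
      have ht : (0 : ℝ) < t := ht
      have hat := mul_nonneg (hα n) ht.le
      have h1 := Real.add_one_le_exp (-(α n * t))
      have h2 : Real.exp (-(α n * t)) ≤ 1 := Real.exp_le_one_iff.2 (by linarith)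
      have h3 : |(t : ℝ)⁻¹ * (Real.exp (-(α n * t)) - 1)| ≤ α n := by
        rw [abs_mul, abs_of_pos (inv_pos.2 ht), inv_mul_le_iff₀ ht, abs_le]
        constructor <;> linarith
      rw [repr_diagonalGenerator]
      simp only [map_smul, map_sub, lp.coeFn_smul, lp.coeFn_sub, Pi.smul_apply, Pi.sub_apply,
        smul_eq_mul, repr_diagonalSemigroup]
      rw [show (t : ℝ)⁻¹ * (Real.exp (-(α n * t)) * b.repr (f : E) n - b.repr (f : E) n) -
        -(α n * b.repr (f : E) n) = ((t : ℝ)⁻¹ * (Real.exp (-(α n * t)) - 1)) * b.repr (f : E) n +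
          α n * b.repr (f : E) n by ring]
      refine (abs_add_le _ _).trans ?_
      rw [abs_mul, abs_mul (α n), abs_of_nonneg (hα n)]
      nlinarith [abs_nonneg (b.repr (f : E) n)]
    · rw [repr_diagonalGenerator]
      exact tendsto_repr_diff_quotient b α hα (f : E) n
  refine ⟨fun f => ⟨fun hf => ⟨_, key ⟨f, hf⟩⟩, ?_⟩, key⟩
  rintro ⟨g, hg⟩
  rw [mem_domain_diagonalGenerator]
  refine (hasSum_repr_sq b g).summable.congr fun n => ?_
  have h1 := ((continuous_repr b n).tendsto g).comp hg
  rw [tendsto_nhds_unique h1 (tendsto_repr_diff_quotient b α hα f n)]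
  ring

end Diagonal

/-! ### Eigenfunctions of polynomial regression -/

/-- A multiplicative function on `[0, ∞)` with values in `[-1, 1]` that tends to `1` at `0` is a
decaying exponential. -/
lemma exists_eq_exp_of_multiplicative {l : ℝ → ℝ}
    (hmul : ∀ s t, 0 ≤ s → 0 ≤ t → l (s + t) = l s * l t) (hle : ∀ t, 0 ≤ t → |l t| ≤ 1)
    (hlim : Tendsto l (𝓝[>] 0) (𝓝 1)) :
    ∃ a : ℝ, 0 ≤ a ∧ ∀ t, 0 ≤ t → l t = Real.exp (-(a * t)) := by
  have hne : ∀ t, 0 ≤ t → l t ≠ 0 := by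
    intro t ht h0
    -- A zero propagates to all smaller arguments `t / 2 ^ k`, hence to the limit at `0`.
    rcases ht.eq_or_lt with rfl | ht
    · have : ∀ s, 0 ≤ s → l s = 0 := fun s hs => by
        rw [← add_zero s, hmul s 0 hs le_rfl, h0, mul_zero]
      have h1 : Tendsto l (𝓝[>] 0) (𝓝 0) := by
        refine tendsto_const_nhds.congr' ?_
        filter_upwards [self_mem_nhdsWithin] with s hs using (this s (le_of_lt hs)).symm
      exact zero_ne_one (tendsto_nhds_unique h1 hlim)
    · have hk : ∀ k : ℕ, l (t / 2 ^ k) = 0 := by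
        intro k
        induction k with
        | zero => simpa using h0
        | succ k ih =>
          have h2 : t / 2 ^ k = t / 2 ^ (k + 1) + t / 2 ^ (k + 1) := by field_simp; ring
          rw [h2, hmul _ _ (by positivity) (by positivity)] at ih
          exact mul_self_eq_zero.1 ih
      have h3 : Tendsto (fun k : ℕ => t / 2 ^ k) atTop (𝓝[>] 0) := by
        refine tendsto_nhdsWithin_iff.2 ⟨?_, Eventually.of_forall fun k => ?_⟩
        · simpa [div_eq_mul_inv] using
            (tendsto_pow_atTop_nhds_zero_of_lt_one (by norm_num : (0 : ℝ) ≤ 2⁻¹)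
              (by norm_num)).const_mul t
        · exact div_pos ht (by positivity)
      have h4 := hlim.comp h3
      have h5 : Tendsto (l ∘ fun k : ℕ => t / 2 ^ k) atTop (𝓝 0) := by
        refine tendsto_const_nhds.congr fun k => ?_
        simp [hk]
      exact zero_ne_one (tendsto_nhds_unique h5 h4)
  have hpos : ∀ t, 0 ≤ t → 0 < l t := by
    intro t ht
    refine lt_of_le_of_ne ?_ (hne t ht).symm
    have := hmul (t / 2) (t / 2) (by linarith) (by linarith)
    rw [add_halves] at this
    rw [this]
    exact mul_self_nonneg _
  set g : ℝ → ℝ := fun t => -Real.log (l t) with hg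
  have gadd : ∀ s t, 0 ≤ s → 0 ≤ t → g (s + t) = g s + g t := by
    intro s t hs ht
    simp only [hg]
    rw [hmul s t hs ht, Real.log_mul (hne s hs) (hne t ht)]
    ring
  have gnonneg : ∀ t, 0 ≤ t → 0 ≤ g t := fun t ht =>
    neg_nonneg.2 (Real.log_nonpos (hpos t ht).le ((le_abs_self _).trans (hle t ht)))
  have gmono : ∀ s t, 0 ≤ s → s ≤ t → g s ≤ g t := by
    intro s t hs hst
    have := gadd s (t - s) hs (by linarith)
    rw [add_sub_cancel] at this
    linarith [gnonneg (t - s) (by linarith)]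
  have gnat : ∀ (n : ℕ) (t : ℝ), 0 ≤ t → g (n * t) = n * g t := by
    intro n t ht
    induction n with
    | zero =>
      have := gadd 0 0 le_rfl le_rfl
      simp only [add_zero] at this
      simp only [Nat.cast_zero, zero_mul]
      linarith
    | succ n ih =>
      push_cast
      rw [add_mul, one_mul, gadd _ _ (by positivity) ht, ih]
      ring
  have hlin : ∀ t, 0 ≤ t → g t = g 1 * t := by
    intro t ht
    have hb : ∀ n : ℕ, n * |g t - g 1 * t| ≤ g 1 := by
      intro n
      have hnt : 0 ≤ n * t := by positivity
      have h1 := Nat.floor_le hnt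
      have h2 := (Nat.lt_floor_add_one (n * t : ℝ)).le
      have h3 := gmono _ _ (by positivity) h1
      have h4 := gmono _ _ hnt h2
      have h5 := gnat ⌊(n * t : ℝ)⌋₊ 1 zero_le_one
      rw [mul_one] at h5
      rw [gadd _ _ (by positivity) zero_le_one, h5, gnat n t ht] at h4
      rw [h5, gnat n t ht] at h3
      have hg1 := gnonneg 1 zero_le_one
      have h6 := mul_le_mul_of_nonneg_right h1 hg1
      have h7 := mul_le_mul_of_nonneg_right h2 hg1
      have h8 : |(n : ℝ) * (g t - g 1 * t)| ≤ g 1 := by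
        rw [abs_le]
        constructor <;> nlinarith
      rwa [abs_mul, Nat.abs_cast] at h8
    by_contra hcon
    have hp : 0 < |g t - g 1 * t| := abs_pos.2 (sub_ne_zero.2 hcon)
    obtain ⟨n, hn⟩ := exists_nat_gt (g 1 / |g t - g 1 * t|)
    rw [div_lt_iff₀ hp] at hn
    exact absurd (hb n) (not_le.2 hn)
  refine ⟨g 1, gnonneg 1 zero_le_one, fun t ht => ?_⟩
  rw [← hlin t ht, hg, neg_neg, Real.exp_log (hpos t ht)]

section Chain

variable {Ω : Type u} [MeasurableSpace Ω] {P : Measure Ω}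
  {X : ℝ → Ω → ℝ} {hX : ∀ t, StronglyMeasurable (X t)} {μ : Measure ℝ}

lemma memLp_eval_comp (hmp : ∀ t, MeasurePreserving (X t) P μ)
    (hμ : ∀ n : ℕ, Integrable (fun x : ℝ => x ^ n) μ) (q : Polynomial ℝ) (t : ℝ) :
    MemLp (fun ω => q.eval (X t ω)) 2 P :=
  (memLp_two_eval hμ q).comp_measurePreserving (hmp t)

lemma integrable_eval_comp [IsProbabilityMeasure P] (hmp : ∀ t, MeasurePreserving (X t) P μ)
    (hμ : ∀ n : ℕ, Integrable (fun x : ℝ => x ^ n) μ) (q : Polynomial ℝ) (t : ℝ) :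
    Integrable (fun ω => q.eval (X t ω)) P :=
  (memLp_eval_comp hmp hμ q t).integrable (by norm_num)

lemma stronglyMeasurable_natural (hX : ∀ t, StronglyMeasurable (X t)) (t : ℝ) :
    StronglyMeasurable[Filtration.natural X hX t] (X t) :=
  Filtration.stronglyAdapted_natural hX t

lemma stronglyMeasurable_eval_natural (hX : ∀ t, StronglyMeasurable (X t)) (q : Polynomial ℝ)
    (t : ℝ) : StronglyMeasurable[Filtration.natural X hX t] fun ω => q.eval (X t ω) :=
  q.continuous.comp_stronglyMeasurable (stronglyMeasurable_natural hX t)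

/-- If the regression of `f (X t)` on the past at time `s` is `c f (X s)`, then the mixed moments of
`f (X t)` and `g (X s)` reduce to the stationary law. -/
lemma integral_eval_mul_eval [IsProbabilityMeasure P] (hmp : ∀ t, MeasurePreserving (X t) P μ)
    (hμ : ∀ n : ℕ, Integrable (fun x : ℝ => x ^ n) μ) {f : Polynomial ℝ} {s t c : ℝ}
    (hc : P[fun ω => f.eval (X t ω) | Filtration.natural X hX s] =ᵐ[P]
      fun ω => c * f.eval (X s ω)) (g : Polynomial ℝ) :
    ∫ ω, f.eval (X t ω) * g.eval (X s ω) ∂P = c * ∫ x, f.eval x * g.eval x ∂μ := by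
  have hfg : Integrable ((fun ω => f.eval (X t ω)) * fun ω => g.eval (X s ω)) P :=
    (memLp_eval_comp hmp hμ f t).integrable_mul (memLp_eval_comp hmp hμ g s)
  have h1 := condExp_mul_of_stronglyMeasurable_right
    (stronglyMeasurable_eval_natural hX g s) hfg (integrable_eval_comp hmp hμ f t)
  have h2 : ∫ ω, f.eval (X t ω) * g.eval (X s ω) ∂P =
      ∫ ω, c * (f.eval (X s ω) * g.eval (X s ω)) ∂P := by
    rw [← integral_condExp ((Filtration.natural X hX).le s)
      (f := fun ω => f.eval (X t ω) * g.eval (X s ω))]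
    refine integral_congr_ae ?_
    filter_upwards [h1, hc] with ω h1 h2
    refine h1.trans ?_
    rw [Pi.mul_apply, h2, mul_assoc]
  rw [h2, integral_const_mul, ← (hmp s).map_eq,
    integral_map (hmp s).measurable.aemeasurable (by fun_prop)]

lemma isUnit_det_coeffMatrix {p : ℕ → Polynomial ℝ} {n : ℕ}
    (hp : ∀ i ≤ n, (p i).Monic ∧ (p i).natDegree = i) : IsUnit (coeffMatrix p n).det := by
  have h : (coeffMatrix p n).det = ∏ i : Fin (n + 1), coeffMatrix p n i i := by
    refine Matrix.det_of_isLowerTriangular _ fun i j hij => ?_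
    have hij' : (i : ℕ) < j := hij
    refine Polynomial.coeff_eq_zero_of_natDegree_lt ?_
    rwa [(hp i (Nat.lt_succ_iff.1 i.2)).2]
  rw [h, Finset.prod_eq_one]
  · exact isUnit_one
  · intro i _
    obtain ⟨h1, h2⟩ := hp i (Nat.lt_succ_iff.1 i.2)
    change (p i).coeff i = 1
    rw [Polynomial.Monic, Polynomial.leadingCoeff, h2] at h1
    exact h1

/-- The polynomials that diagonalize the structural matrices are eigenfunctions of regression. -/
lemma IsSMPR.condExp_eval_eq [IsProbabilityMeasure P] {η : ℝ≥0 → Kernel ℝ ℝ} {γ : ℕ → ℕ → ℝ → ℝ}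
    (hS : IsSMPR P X hX μ η γ) (hmp : ∀ t, MeasurePreserving (X t) P μ) {p : ℕ → Polynomial ℝ}
    {n : ℕ} (hn : (n : ℕ∞) < supportSize μ) (hp : ∀ i ≤ n, (p i).Monic ∧ (p i).natDegree = i)
    {τ : ℝ} (hτ : 0 < τ) {d : Fin (n + 1) → ℝ}
    (hd : structuralMatrix γ n τ = (coeffMatrix p n)⁻¹ * Matrix.diagonal d * coeffMatrix p n)
    (s : ℝ) : P[fun ω => (p n).eval (X (s + τ) ω) | Filtration.natural X hX s] =ᵐ[P]
      fun ω => d (Fin.last n) * (p n).eval (X s ω) := by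
  have hWA : coeffMatrix p n * structuralMatrix γ n τ =
      Matrix.diagonal d * coeffMatrix p n := by
    rw [hd, Matrix.mul_assoc, Matrix.mul_nonsing_inv_cancel_left _ _ (isUnit_det_coeffMatrix hp)]
  have heval : ∀ x, (p n).eval x = ∑ i : Fin (n + 1), (p n).coeff i * x ^ (i : ℕ) := by
    intro x
    rw [Polynomial.eval_eq_sum_range, (hp n le_rfl).2,
      Finset.sum_range fun i => (p n).coeff i * x ^ i]
  have hreg : ∀ i : Fin (n + 1), P[fun ω => X (s + τ) ω ^ (i : ℕ) | Filtration.natural X hX s]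
      =ᵐ[P] fun ω => ∑ j : Fin (n + 1), structuralMatrix γ n τ i j * X s ω ^ (j : ℕ) := by
    intro i
    have hi : ((i : ℕ) : ℕ∞) < supportSize μ :=
      lt_of_le_of_lt (Nat.cast_le.2 (Nat.lt_succ_iff.1 i.2)) hn
    filter_upwards [hS.regression i hi s τ hτ] with ω hω
    rw [hω]
    have h1 : ∑ j : Fin (n + 1), structuralMatrix γ n τ i j * X s ω ^ (j : ℕ) =
        ∑ j ∈ Finset.range (n + 1), (if j ≤ (i : ℕ) then γ i j τ else 0) * X s ω ^ j := by
      rw [Finset.sum_range]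
      refine Finset.sum_congr rfl fun j _ => ?_
      simp only [structuralMatrix, Matrix.of_apply, Fin.le_def]
    rw [h1]
    have h2 : ∑ j ∈ Finset.range (i + 1), γ i j τ * X s ω ^ j =
        ∑ j ∈ Finset.range (i + 1), (if j ≤ (i : ℕ) then γ i j τ else 0) * X s ω ^ j := by
      refine Finset.sum_congr rfl fun j hj => ?_
      rw [if_pos (Nat.lt_succ_iff.1 (Finset.mem_range.1 hj))]
    rw [h2]
    refine Finset.sum_subset (Finset.range_mono i.2) fun j _ hj => ?_
    rw [if_neg fun h => hj (Finset.mem_range.2 (Nat.lt_succ_of_le h)), zero_mul]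
  have hint : ∀ i : Fin (n + 1), Integrable (fun ω => X (s + τ) ω ^ (i : ℕ)) P := fun i => by
    simpa using integrable_eval_comp hmp hS.identifiable.1 (Polynomial.X ^ (i : ℕ)) (s + τ)
  have h1 : (fun ω => (p n).eval (X (s + τ) ω)) =
      ∑ i : Fin (n + 1), (p n).coeff i • fun ω => X (s + τ) ω ^ (i : ℕ) := by
    ext ω
    simp [heval]
  rw [h1]
  refine (condExp_finsetSum (fun i _ => (hint i).smul _) _).trans ?_
  have h2 : ∀ᵐ ω ∂P, ∀ i : Fin (n + 1),
      P[(p n).coeff i • fun ω => X (s + τ) ω ^ (i : ℕ) | Filtration.natural X hX s] ω =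
      (p n).coeff i * ∑ j : Fin (n + 1), structuralMatrix γ n τ i j * X s ω ^ (j : ℕ) := by
    rw [ae_all_iff]
    intro i
    filter_upwards [hreg i, condExp_smul ((p n).coeff i) (fun ω => X (s + τ) ω ^ (i : ℕ))
      (Filtration.natural X hX s) (μ := P)] with ω hω hω'
    rw [hω', Pi.smul_apply, hω, smul_eq_mul]
  filter_upwards [h2] with ω hω
  rw [Finset.sum_apply]
  simp only [hω]
  have h3 : ∀ j : Fin (n + 1), ∑ i : Fin (n + 1), (p n).coeff i * structuralMatrix γ n τ i j =
      d (Fin.last n) * (p n).coeff j := by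
    intro j
    have := congrFun (congrFun hWA (Fin.last n)) j
    rw [Matrix.diagonal_mul] at this
    rw [Matrix.mul_apply] at this
    simpa [coeffMatrix] using this
  calc ∑ i : Fin (n + 1), (p n).coeff i * ∑ j : Fin (n + 1),
        structuralMatrix γ n τ i j * X s ω ^ (j : ℕ)
      = ∑ j : Fin (n + 1), (∑ i : Fin (n + 1), (p n).coeff i * structuralMatrix γ n τ i j) *
          X s ω ^ (j : ℕ) := by
        simp only [Finset.mul_sum, Finset.sum_mul]
        rw [Finset.sum_comm]
        simp only [mul_assoc]
    _ = _ := by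
        simp only [h3, heval, Finset.mul_sum, mul_assoc]

end Chain

/-! ### The martingale system of a regular process -/

section System

variable {Ω : Type u} [MeasurableSpace Ω] {P : Measure Ω}
  {X : ℝ → Ω → ℝ} {hX : ∀ t, StronglyMeasurable (X t)} {μ : Measure ℝ}

lemma IsSMPR.measurePreserving {η : ℝ≥0 → Kernel ℝ ℝ} {γ : ℕ → ℕ → ℝ → ℝ}
    (hS : IsSMPR P X hX μ η γ) (t : ℝ) : MeasurePreserving (X t) P μ :=
  ⟨(hX t).measurable, hS.law_eq t⟩

lemma IsSMPR.continuousAt_integral_eval {η : ℝ≥0 → Kernel ℝ ℝ} {γ : ℕ → ℕ → ℝ → ℝ}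
    (hS : IsSMPR P X hX μ η γ) (f g : Polynomial ℝ) (s : ℝ) :
    ContinuousAt (fun t => ∫ ω, f.eval (X t ω) * g.eval (X s ω) ∂P) s := by
  have hmp := hS.measurePreserving
  have hμ := hS.identifiable.1
  have hint : ∀ (f g : Polynomial ℝ) (t : ℝ),
      Integrable (fun ω => f.eval (X t ω) * g.eval (X s ω)) P := fun f g t =>
    (memLp_eval_comp hmp hμ f t).integrable_mul (memLp_eval_comp hmp hμ g s)
  induction f using Polynomial.induction_on' with
  | add f₁ f₂ h₁ h₂ =>
    refine (h₁.add h₂).congr (Eventually.of_forall fun t => ?_)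
    simp only [Polynomial.eval_add, add_mul]
    exact (integral_add (hint f₁ g t) (hint f₂ g t)).symm
  | monomial m a =>
    induction g using Polynomial.induction_on' with
    | add g₁ g₂ h₁ h₂ =>
      refine (h₁.add h₂).congr (Eventually.of_forall fun t => ?_)
      simp only [Polynomial.eval_add, mul_add]
      exact (integral_add (hint _ g₁ t) (hint _ g₂ t)).symm
    | monomial j c =>
      refine ((hS.msc m j s).const_mul (a * c)).congr (Eventually.of_forall fun t => ?_)
      simp only [Polynomial.eval_monomial]
      rw [← integral_const_mul]
      congr 1
      ext ω
      ring

variable [IsProbabilityMeasure P]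

lemma IsSMPR.isProbabilityMeasure {η : ℝ≥0 → Kernel ℝ ℝ} {γ : ℕ → ℕ → ℝ → ℝ}
    (hS : IsSMPR P X hX μ η γ) : IsProbabilityMeasure μ :=
  hS.law_eq 0 ▸ Measure.isProbabilityMeasure_map (hX 0).measurable.aemeasurable

/-- If regression multiplies a polynomial, not almost everywhere zero, by some factor for each time
lag, then this factor decays exponentially. -/
lemma IsSMPR.exists_condExp_eval_eq_exp {η : ℝ≥0 → Kernel ℝ ℝ} {γ : ℕ → ℕ → ℝ → ℝ}
    (hS : IsSMPR P X hX μ η γ) {f : Polynomial ℝ} (hf : 0 < ∫ x, f.eval x * f.eval x ∂μ)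
    (hreg : ∀ τ, 0 < τ → ∃ c : ℝ, ∀ s,
      P[fun ω => f.eval (X (s + τ) ω) | Filtration.natural X hX s] =ᵐ[P]
        fun ω => c * f.eval (X s ω)) :
    ∃ a : ℝ, 0 ≤ a ∧ ∀ s τ, 0 ≤ τ →
      P[fun ω => f.eval (X (s + τ) ω) | Filtration.natural X hX s] =ᵐ[P]
        fun ω => Real.exp (-(a * τ)) * f.eval (X s ω) := by
  have hmp := hS.measurePreserving
  have hμ := hS.identifiable.1
  set N := ∫ x, f.eval x * f.eval x ∂μ with hN
  set l : ℝ → ℝ := fun τ => (∫ ω, f.eval (X τ ω) * f.eval (X 0 ω) ∂P) / N with hl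
  have hl0 : l 0 = 1 := by
    have : ∫ ω, f.eval (X 0 ω) * f.eval (X 0 ω) ∂P = N := by
      rw [hN, ← (hmp 0).map_eq,
        integral_map (hmp 0).measurable.aemeasurable (by fun_prop)]
    rw [hl]
    simp only [this]
    exact div_self hf.ne'
  have hlc : ∀ c s τ, P[fun ω => f.eval (X (s + τ) ω) | Filtration.natural X hX s] =ᵐ[P]
        (fun ω => c * f.eval (X s ω)) →
      ∫ ω, f.eval (X (s + τ) ω) * f.eval (X s ω) ∂P = c * N := fun c s τ h =>
    integral_eval_mul_eval hmp hμ h f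
  have hreg' : ∀ s τ, 0 ≤ τ →
      P[fun ω => f.eval (X (s + τ) ω) | Filtration.natural X hX s] =ᵐ[P]
        fun ω => l τ * f.eval (X s ω) := by
    intro s τ hτ
    rcases hτ.eq_or_lt with rfl | hτ
    · rw [hl0, add_zero, condExp_of_stronglyMeasurable ((Filtration.natural X hX).le s)
        (stronglyMeasurable_eval_natural hX f s) (integrable_eval_comp hmp hμ f s)]
      simp
    · obtain ⟨c, hc⟩ := hreg τ hτ
      have h1 := hlc c 0 τ (hc 0)
      have : l τ = c := by
        rw [zero_add] at h1
        rw [hl]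
        simp only [h1]
        exact mul_div_cancel_right₀ _ hf.ne'
      rw [this]
      exact hc s
  have hmul : ∀ s t, 0 ≤ s → 0 ≤ t → l (s + t) = l s * l t := by
    intro s t hs ht
    have h1 : P[fun ω => f.eval (X (0 + (s + t)) ω) | Filtration.natural X hX 0] =ᵐ[P]
        fun ω => (l s * l t) * f.eval (X 0 ω) := by
      have h2 := condExp_condExp_of_le (μ := P) (f := fun ω => f.eval (X (0 + (s + t)) ω))
        ((Filtration.natural X hX).mono (by linarith : (0 : ℝ) ≤ 0 + s))
        ((Filtration.natural X hX).le (0 + s))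
      refine h2.symm.trans ?_
      have h3 := hreg' (0 + s) t ht
      rw [add_assoc] at h3
      refine (condExp_congr_ae h3).trans ?_
      refine (condExp_smul (l t) (fun ω => f.eval (X (0 + s) ω)) _).trans ?_
      filter_upwards [hreg' 0 s hs] with ω hω
      rw [Pi.smul_apply, hω, smul_eq_mul]
      ring
    have h4 := hlc _ 0 _ h1
    have h5 := hlc _ 0 _ (hreg' 0 (s + t) (by linarith))
    exact mul_right_cancel₀ hf.ne' (h5.symm.trans h4)
  have hle : ∀ t, 0 ≤ t → |l t| ≤ 1 := by
    intro t ht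
    rw [hl]
    simp only
    rw [abs_div, abs_of_pos hf, div_le_one hf]
    refine (abs_integral_mul_le_sqrt (memLp_eval_comp hmp hμ f t)
      (memLp_eval_comp hmp hμ f 0)).trans_eq ?_
    have : ∀ s, ∫ ω, f.eval (X s ω) ^ 2 ∂P = N := by
      intro s
      rw [hN, ← (hmp s).map_eq,
        integral_map (hmp s).measurable.aemeasurable (by fun_prop)]
      simp only [sq]
    rw [this, this, Real.mul_self_sqrt hf.le]
  have hlim : Tendsto l (𝓝[>] 0) (𝓝 1) := by
    have := (hS.continuousAt_integral_eval f f 0).div_const N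
    have h2 : Tendsto l (𝓝 0) (𝓝 (l 0)) := this
    rw [hl0] at h2
    exact h2.mono_left nhdsWithin_le_nhds
  obtain ⟨a, ha, hla⟩ := exists_eq_exp_of_multiplicative hmul hle hlim
  refine ⟨a, ha, fun s τ hτ => ?_⟩
  rw [← hla τ hτ]
  exact hreg' s τ hτ

/-- Normalizing the diagonalizing polynomials of a regular process gives a system of orthogonal
martingales. -/
lemma IsRSMPR.exists_isMartingaleSystem {η : ℝ≥0 → Kernel ℝ ℝ} (hR : IsRSMPR P X hX μ η) :
    ∃ (h : ℕ → Polynomial ℝ) (α : ℕ → ℝ), h 0 = 1 ∧ α 0 = 0 ∧ IsMartingaleSystem P X hX μ h α := by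
  obtain ⟨γ, hS, p, hp, hdiag, horth⟩ := hR
  have hmp := hS.measurePreserving
  have hμ := hS.identifiable.1
  have := hS.isProbabilityMeasure
  have hle : ∀ n : ℕ, (n : ℕ∞) < supportSize μ → ∀ i ≤ n, (p i).Monic ∧ (p i).natDegree = i :=
    fun n hn i hi => hp i (lt_of_le_of_lt (Nat.cast_le.2 hi) hn)
  have hN : ∀ n : ℕ, (n : ℕ∞) < supportSize μ →
      0 < ∫ x, (p n).eval x * (p n).eval x ∂μ := by
    intro n hn
    refine lt_of_le_of_ne (integral_nonneg fun x => mul_self_nonneg _) fun h => ?_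
    have h1 := (integral_eq_zero_iff_of_nonneg (fun x => mul_self_nonneg ((p n).eval x))
      ((memLp_two_eval hμ (p n)).integrable_mul (memLp_two_eval hμ (p n)))).1 h.symm
    refine not_ae_eval_eq_zero (hp n hn).1.ne_zero (by rwa [(hp n hn).2]) ?_
    filter_upwards [h1] with x hx using mul_self_eq_zero.1 hx
  have hα : ∀ n : ℕ, ∃ a : ℝ, (n : ℕ∞) < supportSize μ → 0 ≤ a ∧ ∀ s τ, 0 ≤ τ →
      P[fun ω => (p n).eval (X (s + τ) ω) | Filtration.natural X hX s] =ᵐ[P]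
        fun ω => Real.exp (-(a * τ)) * (p n).eval (X s ω) := by
    intro n
    by_cases hn : (n : ℕ∞) < supportSize μ
    · obtain ⟨a, ha⟩ := hS.exists_condExp_eval_eq_exp (hN n hn) fun τ hτ => by
        obtain ⟨d, hd⟩ := hdiag n hn τ hτ
        exact ⟨_, fun s => hS.condExp_eval_eq hmp hn (hle n hn) hτ hd s⟩
      exact ⟨a, fun _ => ha⟩
    · exact ⟨0, fun h => absurd h hn⟩
  choose α hα using hα
  set c : ℕ → ℝ := fun n => (√(∫ x, (p n).eval x * (p n).eval x ∂μ))⁻¹ with hc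
  have h0 := supportSize_pos μ
  have hp0 : p 0 = 1 := Polynomial.eq_one_of_monic_natDegree_zero (hp 0 h0).1 (hp 0 h0).2
  have hc0 : c 0 = 1 := by simp [hc, hp0]
  have hcpos : ∀ n : ℕ, (n : ℕ∞) < supportSize μ → 0 < c n := fun n hn =>
    inv_pos.2 (Real.sqrt_pos.2 (hN n hn))
  have hinner : ∀ m n : Idx μ,
      ∫ x, (Polynomial.C (c m) * p m).eval x * (Polynomial.C (c n) * p n).eval x ∂μ =
        if m = n then 1 else 0 := by
    intro m n
    have h1 : ∫ x, (Polynomial.C (c m) * p m).eval x * (Polynomial.C (c n) * p n).eval x ∂μ =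
        (c m * c n) * ∫ x, (p m).eval x * (p n).eval x ∂μ := by
      rw [← integral_const_mul]
      congr 1
      ext x
      simp only [Polynomial.eval_mul, Polynomial.eval_C]
      ring
    rw [h1]
    split_ifs with hmn
    · rw [hmn, hc]
      simp only
      rw [← mul_inv, Real.mul_self_sqrt (hN n n.2).le, inv_mul_cancel₀ (hN n n.2).ne']
    · rw [horth m n m.2 n.2 fun h => hmn (Subtype.ext h), mul_zero]
  have hreg : ∀ (n : Idx μ) (s t : ℝ), s ≤ t →
      P[fun ω => (Polynomial.C (c n) * p n).eval (X t ω) | Filtration.natural X hX s] =ᵐ[P]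
        fun ω => Real.exp (-(α n * (t - s))) * (Polynomial.C (c n) * p n).eval (X s ω) := by
    intro n s t hst
    have h1 := (hα n n.2).2 s (t - s) (by linarith)
    rw [add_sub_cancel] at h1
    simp only [Polynomial.eval_mul, Polynomial.eval_C]
    refine (condExp_smul (c n) (fun ω => (p n).eval (X t ω)) _).trans ?_
    filter_upwards [h1] with ω hω
    rw [Pi.smul_apply, hω, smul_eq_mul]
    ring
  refine ⟨fun n => Polynomial.C (c n) * p n, α, by simp [hc0, hp0], ?_, ?_⟩
  · have h1 := (hα 0 h0).2 0 1 zero_le_one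
    rw [hp0] at h1
    simp only [Polynomial.eval_one, mul_one] at h1
    rw [condExp_const ((Filtration.natural X hX).le 0)] at h1
    obtain ⟨ω, hω⟩ := h1.exists
    have := hω.symm
    rw [Real.exp_eq_one_iff] at this
    linarith
  · refine ⟨fun n => ?_, hinner, fun n => (hα n n.2).1, fun n => ⟨fun t => ?_, fun s t hst => ?_⟩,
      fun m n hmn s t => ?_⟩
    · rw [Polynomial.natDegree_C_mul (hcpos n n.2).ne', (hp n n.2).2]
    · exact (stronglyMeasurable_eval_natural hX _ t).const_mul _
    · refine (condExp_smul (Real.exp (α n * t))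
        (fun ω => (Polynomial.C (c n) * p n).eval (X t ω)) _).trans ?_
      filter_upwards [hreg n s t hst] with ω hω
      rw [Pi.smul_apply, hω, smul_eq_mul, ← mul_assoc, ← Real.exp_add]
      congr 2
      ring
    -- The regression is taken on the past of the earlier time, which may belong to either index.
    · have key : ∀ (m n : Idx μ), m ≠ n → ∀ s t : ℝ, s ≤ t →
          ∫ ω, (Polynomial.C (c n) * p n).eval (X t ω) *
            (Polynomial.C (c m) * p m).eval (X s ω) ∂P = 0 := by
        intro m n hmn s t hst
        rw [integral_eval_mul_eval hmp hμ (hreg n s t hst), hinner n m, if_neg hmn.symm, mul_zero]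
      have h1 : ∫ ω, (Real.exp (α m * s) * (Polynomial.C (c m) * p m).eval (X s ω)) *
          (Real.exp (α n * t) * (Polynomial.C (c n) * p n).eval (X t ω)) ∂P =
          (Real.exp (α m * s) * Real.exp (α n * t)) *
          ∫ ω, (Polynomial.C (c m) * p m).eval (X s ω) *
            (Polynomial.C (c n) * p n).eval (X t ω) ∂P := by
        rw [← integral_const_mul]
        congr 1
        ext ω
        ring
      rw [h1]
      rcases le_total s t with hst | hst
      · have := key m n hmn s t hst
        simp only [mul_comm ((Polynomial.C (c n) * p n).eval _)] at this
        rw [this, mul_zero]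
      · rw [key n m hmn.symm t s hst, mul_zero]

end System

/-! ### Transition operators and Fourier coefficients of densities -/

section Transition

variable {Ω : Type u} [MeasurableSpace Ω] {P : Measure Ω}
  {X : ℝ → Ω → ℝ} {hX : ∀ t, StronglyMeasurable (X t)} {μ : Measure ℝ}
  {h : ℕ → Polynomial ℝ} {α : ℕ → ℝ}

lemma IsMartingaleSystem.isOrthonormalSystem (hM : IsMartingaleSystem P X hX μ h α) :
    IsOrthonormalSystem μ h :=
  ⟨hM.natDegree_eq, hM.orthonormal⟩

/-- The semigroup on `L²(μ)` that multiplies the `n`-th polynomial of a martingale system by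
`exp (-α n t)`. -/
noncomputable def IsMartingaleSystem.semigroup [IsProbabilityMeasure μ]
    (hM : IsMartingaleSystem P X hX μ h α) (hμ : IdentifiableByMoments μ) (t : ℝ≥0) :
    Lp ℝ 2 μ →L[ℝ] Lp ℝ 2 μ :=
  diagonalSemigroup (hM.isOrthonormalSystem.hilbertBasis hμ) (fun n : Idx μ => α n) hM.nonneg t

lemma IsMartingaleSystem.condExp_eval (hM : IsMartingaleSystem P X hX μ h α) (n : Idx μ) (s : ℝ)
    (t : ℝ≥0) : P[fun ω => (h n).eval (X (s + t) ω) | Filtration.natural X hX s] =ᵐ[P]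
      fun ω => Real.exp (-(α n * t)) * (h n).eval (X s ω) := by
  have h1 := (hM.martingale n).2 s (s + t) (by simp)
  have h2 : (fun ω => (h n).eval (X (s + t) ω)) = (Real.exp (α n * (s + t)))⁻¹ •
      fun ω => Real.exp (α n * (s + t)) * (h n).eval (X (s + t) ω) := by
    ext ω
    rw [Pi.smul_apply, smul_eq_mul, inv_mul_cancel_left₀ (Real.exp_ne_zero _)]
  rw [h2]
  refine (condExp_smul _ _ _).trans ?_
  filter_upwards [h1] with ω hω
  rw [Pi.smul_apply, hω, smul_eq_mul, ← mul_assoc, ← Real.exp_neg, ← Real.exp_add]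
  congr 2
  ring

variable [IsProbabilityMeasure P]

lemma condExp_comap_eq_of_condExp_natural_eq (hmp : ∀ t, MeasurePreserving (X t) P μ) {t : ℝ}
    {f g : Lp ℝ 2 μ} (hfg : P[fun ω => f (X (0 + t) ω) | Filtration.natural X hX 0] =ᵐ[P]
      fun ω => g (X 0 ω)) :
    P[fun ω => f (X t ω) | MeasurableSpace.comap (X 0) inferInstance] =ᵐ[P]
      fun ω => g (X 0 ω) := by
  have hle : MeasurableSpace.comap (X 0) inferInstance ≤ Filtration.natural X hX 0 :=
    le_iSup₂_of_le (f := fun j (_ : j ≤ (0 : ℝ)) => MeasurableSpace.comap (X j) inferInstance)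
      0 le_rfl le_rfl
  rw [zero_add] at hfg
  have h1 := condExp_condExp_of_le (μ := P) (f := fun ω => f (X t ω)) hle
    ((Filtration.natural X hX).le 0)
  refine h1.symm.trans ((condExp_congr_ae hfg).trans ?_)
  have h2 : MemLp (fun ω => g (X 0 ω)) 2 P := (Lp.memLp g).comp_measurePreserving (hmp 0)
  rw [condExp_of_stronglyMeasurable (hle.trans ((Filtration.natural X hX).le 0)) _
    (h2.integrable (by norm_num))]
  exact (Lp.stronglyMeasurable g).comp_measurable (comap_measurable (X 0))

variable [IsProbabilityMeasure μ]

/-- The semigroup of a martingale system gives the regression of all square integrable functions of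
the process on its past: both sides are continuous linear maps of the function, and they agree on
the basis by the martingale property. -/
lemma IsMartingaleSystem.condExp_eq_semigroup (hM : IsMartingaleSystem P X hX μ h α)
    (hμ : IdentifiableByMoments μ) (hmp : ∀ t, MeasurePreserving (X t) P μ) (s : ℝ) (t : ℝ≥0)
    (f : Lp ℝ 2 μ) : P[fun ω => f (X (s + t) ω) | Filtration.natural X hX s] =ᵐ[P]
      fun ω => hM.semigroup hμ t f (X s ω) := by
  set b := hM.isOrthonormalSystem.hilbertBasis hμ with hb
  have hm := (Filtration.natural X hX).le s
  let V : ℝ → Lp ℝ 2 μ →L[ℝ] Lp ℝ 2 P := fun r =>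
    (Lp.compMeasurePreservingₗᵢ ℝ (X r) (hmp r)).toContinuousLinearMap
  have hV : ∀ r (f : Lp ℝ 2 μ), (V r f : Ω → ℝ) =ᵐ[P] fun ω => f (X r ω) := fun r f =>
    Lp.coeFn_compMeasurePreserving f (hmp r)
  let Φ : Lp ℝ 2 μ →L[ℝ] Lp ℝ 2 P :=
    (lpMeas ℝ ℝ (Filtration.natural X hX s) 2 P).subtypeL ∘L condExpL2 ℝ ℝ hm ∘L V (s + t)
  have hΦ : ∀ f : Lp ℝ 2 μ, (Φ f : Ω → ℝ) =ᵐ[P]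
      P[fun ω => f (X (s + t) ω) | Filtration.natural X hX s] := by
    intro f
    have h1 := (Lp.memLp (V (s + t) f)).condExpL2_ae_eq_condExp (𝕜 := ℝ) hm
    rw [Lp.toLp_coeFn] at h1
    exact h1.trans (condExp_congr_ae (hV _ f))
  have hbasis : ∀ n, Φ (b n) = V s (hM.semigroup hμ t (b n)) := by
    intro n
    apply Lp.ext
    have hbn : (b n : ℝ → ℝ) =ᵐ[μ] fun x => (h n).eval x := by
      rw [hb, IsOrthonormalSystem.hilbertBasis_apply]
      exact coeFn_evalLp hμ.1 _
    have h1 : P[fun ω => b n (X (s + t) ω) | Filtration.natural X hX s] =ᵐ[P]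
        P[fun ω => (h n).eval (X (s + t) ω) | Filtration.natural X hX s] :=
      condExp_congr_ae ((hmp (s + t)).quasiMeasurePreserving.ae_eq_comp hbn)
    have h2 : hM.semigroup hμ t (b n) = Real.exp (-(α n * t)) • b n :=
      diagonalSemigroup_basis _ _ _ _ _
    rw [h2, map_smul]
    refine (hΦ _).trans (h1.trans ((hM.condExp_eval n s t).trans ?_))
    filter_upwards [Lp.coeFn_smul (Real.exp (-(α n * t))) (V s (b n)), hV s (b n),
      (hmp s).quasiMeasurePreserving.ae_eq_comp hbn] with ω h3 h4 h5
    rw [h3, Pi.smul_apply, h4, smul_eq_mul]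
    exact congrArg _ h5.symm
  have heq : Φ = V s ∘L hM.semigroup hμ t := by
    refine ContinuousLinearMap.ext_on
      (Submodule.dense_iff_topologicalClosure_eq_top.2 b.dense_span) ?_
    rintro _ ⟨n, rfl⟩
    exact hbasis n
  refine (hΦ f).symm.trans ?_
  rw [heq]
  exact hV s _

/-- The joint law of the states at two times is given by the transition kernel. -/
lemma IsSMPR.map_prodMk_eq_compProd {η : ℝ≥0 → Kernel ℝ ℝ} {γ : ℕ → ℕ → ℝ → ℝ}
    (hS : IsSMPR P X hX μ η γ) (t : ℝ≥0) :
    P.map (fun ω => (X 0 ω, X t ω)) = μ ⊗ₘ η t := by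
  have := hS.isMarkovKernel t
  have hm0 := (hX 0).measurable
  have hmt := (hX t).measurable
  have : IsProbabilityMeasure (P.map fun ω => (X 0 ω, X t ω)) :=
    Measure.isProbabilityMeasure_map (by fun_prop)
  refine Measure.ext_prod fun {A B} hA hB => ?_
  rw [Measure.map_apply (by fun_prop) (hA.prod hB), Measure.compProd_apply_prod hA hB]
  have hA0 : MeasurableSet[Filtration.natural X hX 0] (X 0 ⁻¹' A) :=
    (stronglyMeasurable_natural hX 0).measurable hA
  have h1 := hS.markov 0 t B hB
  rw [zero_add] at h1
  have h2 : Integrable ((X t ⁻¹' B).indicator fun _ => (1 : ℝ)) P :=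
    (integrable_const 1).indicator (hmt hB)
  have h3 := setIntegral_condExp ((Filtration.natural X hX).le 0) h2 hA0
  rw [setIntegral_congr_ae (hm0 hA) (h1.mono fun ω hω _ => hω),
    setIntegral_indicator (hmt hB), setIntegral_const, smul_eq_mul, mul_one] at h3
  have h4 : ∫ ω in X 0 ⁻¹' A, (η t (X 0 ω)).real B ∂P = ∫ y in A, (η t y).real B ∂μ := by
    rw [← hS.law_eq 0, setIntegral_map hA _ hm0.aemeasurable]
    exact ((η t).measurable_coe hB).ennreal_toReal.aestronglyMeasurable
  rw [h4] at h3
  have h5 : ∫ y in A, (η t y).real B ∂μ = (∫⁻ y in A, η t y B ∂μ).toReal :=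
    integral_toReal ((η t).measurable_coe hB).aemeasurable
      (ae_of_all _ fun y => measure_lt_top _ _)
  rw [h5] at h3
  have h6 : X 0 ⁻¹' A ∩ X t ⁻¹' B = (fun ω => (X 0 ω, X t ω)) ⁻¹' A ×ˢ B := rfl
  rw [h6] at h3
  refine ((ENNReal.toReal_eq_toReal_iff' ?_ (measure_ne_top _ _)).1 h3).symm
  refine ((lintegral_mono fun y => prob_le_one).trans_lt ?_).ne
  simp

lemma IsSMPR.ae_integrable_and_eq_integral {η : ℝ≥0 → Kernel ℝ ℝ} {γ : ℕ → ℕ → ℝ → ℝ}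
    (hS : IsSMPR P X hX μ η γ) (t : ℝ≥0) {f g : Lp ℝ 2 μ}
    (hfg : P[fun ω => f (X t ω) | MeasurableSpace.comap (X 0) inferInstance] =ᵐ[P]
      fun ω => g (X 0 ω)) :
    ∀ᵐ y ∂μ, Integrable f (η t y) ∧ g y = ∫ x, f x ∂(η t y) := by
  have := hS.isMarkovKernel t
  have hm0 := (hX 0).measurable
  have hmt := (hX t).measurable
  have hjoint := hS.map_prodMk_eq_compProd t
  have hfi : Integrable (fun ω => f (X t ω)) P :=
    ((Lp.memLp f).comp_measurePreserving (hS.measurePreserving t)).integrable (by norm_num)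
  have hfsm := Lp.stronglyMeasurable f
  have h1 : ∀ᵐ y ∂μ, Integrable f (η t y) := by
    have h2 : Integrable (fun z : ℝ × ℝ => f z.2) (μ ⊗ₘ η t) := by
      rw [← hjoint]
      exact (integrable_map_measure (f := fun ω => (X 0 ω, X t ω)) (g := fun z : ℝ × ℝ => f z.2)
        (hfsm.comp_measurable measurable_snd).aestronglyMeasurable (by fun_prop)).2 hfi
    exact ((Measure.integrable_compProd_iff h2.aestronglyMeasurable).1 h2).1
  have h3 : condDistrib (X t) (X 0) P =ᵐ[μ] η t := by
    have := condDistrib_ae_eq_of_measure_eq_compProd (μ := P) (κ := η t) (X 0)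
      hmt.aemeasurable (by rw [hjoint, hS.law_eq])
    rwa [hS.law_eq] at this
  have h4 := condExp_ae_eq_integral_condDistrib (μ := P) hm0 hmt.aemeasurable hfsm hfi
  have h5 : ∀ᵐ ω ∂P, g (X 0 ω) = ∫ x, f x ∂(η t (X 0 ω)) := by
    filter_upwards [h4, hfg, (hS.measurePreserving 0).quasiMeasurePreserving.ae h3]
      with ω a1 a2 a3
    rw [← a2, a1, a3]
  have h6 : ∀ᵐ y ∂μ, g y = ∫ x, f x ∂(η t y) := by
    have h7 := (ae_map_iff hm0.aemeasurable (measurableSet_eq_fun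
      (Lp.stronglyMeasurable g).measurable hfsm.integral_kernel.measurable)).2 h5
    rwa [hS.law_eq] at h7
  filter_upwards [h1, h6] with y a1 a2 using ⟨a1, a2⟩

end Transition

section Density

variable {μ : Measure ℝ} {h : ℕ → Polynomial ℝ}

/-- The Fourier coefficients of a square integrable density are the integrals of the representatives
of the polynomials in `L²(μ)`, whatever their choice on null sets. -/
lemma integral_eval_mul_density (hμ : IdentifiableByMoments μ)
    {ρ : Measure ℝ} {k : ℝ → ℝ≥0∞} (hk : Measurable k) (hρ : ρ = μ.withDensity k)
    (hk2 : ∫⁻ x, k x ^ 2 ∂μ < ∞) (p : Polynomial ℝ) :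
    ∫ x, p.eval x * (k x).toReal ∂μ = ∫ x, evalLp hμ.1 p x ∂ρ := by
  have hfin : ∀ᵐ x ∂μ, k x < ∞ := by
    filter_upwards [ae_lt_top (hk.pow_const 2) hk2.ne] with x hx
    exact lt_top_iff_ne_top.2 fun h => by simp [h] at hx
  have h1 : ∫ x, evalLp hμ.1 p x ∂ρ = ∫ x, p.eval x ∂ρ := by
    refine integral_congr_ae ?_
    have hac : ρ ≪ μ := hρ ▸ withDensity_absolutelyContinuous μ k
    exact hac.ae_le (coeFn_evalLp hμ.1 p)
  rw [h1, hρ, integral_withDensity_eq_integral_toReal_smul hk hfin]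
  simp only [smul_eq_mul, mul_comm]

variable [IsProbabilityMeasure μ]

/-- Orthogonal expansion of a function in `L²(μ)`, together with Bessel's inequality for the
remainders. -/
lemma IsOrthonormalSystem.tendsto_eLpNorm_sub_sum (hh : IsOrthonormalSystem μ h)
    (hμ : IdentifiableByMoments μ) {k : ℝ → ℝ} (hk : MemLp k 2 μ) {c : Idx μ → ℝ}
    (hc : ∀ n : Idx μ, ∫ x, (h n).eval x * k x ∂μ = c n) :
    Tendsto (fun S : Finset (Idx μ) => eLpNorm (fun x => k x - ∑ n ∈ S, c n * (h n).eval x) 2 μ)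
      atTop (𝓝 0) ∧
    ∀ S : Finset (Idx μ), eLpNorm (fun x => k x - ∑ n ∈ S, c n * (h n).eval x) 2 μ ≤
      eLpNorm k 2 μ := by
  classical
  set b := hh.hilbertBasis hμ with hb
  set K : Lp ℝ 2 μ := hk.toLp k with hK
  have hbn : ∀ n, b n = evalLp hμ.1 (h n) := hh.hilbertBasis_apply hμ
  have hrepr : ∀ n, b.repr K n = c n := by
    intro n
    rw [b.repr_apply_apply, hbn, inner_evalLp, ← hc n]
    refine integral_congr_ae ?_
    filter_upwards [hk.coeFn_toLp] with x hx
    rw [hx]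
  have hnorm : ∀ S : Finset (Idx μ), eLpNorm (fun x => k x - ∑ n ∈ S, c n * (h n).eval x) 2 μ =
      ‖K - ∑ n ∈ S, c n • b n‖ₑ := by
    intro S
    rw [Lp.enorm_def]
    refine eLpNorm_congr_ae ?_
    have h1 : ((∑ n ∈ S, c n • b n : Lp ℝ 2 μ) : ℝ → ℝ) =ᵐ[μ]
        fun x => ∑ n ∈ S, c n * (h n).eval x := by
      induction S using Finset.induction_on with
      | empty =>
        simp only [Finset.sum_empty]
        exact Lp.coeFn_zero ℝ 2 μ
      | insert n S hn ih =>
        rw [Finset.sum_insert hn]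
        filter_upwards [Lp.coeFn_add (c n • b n) (∑ n ∈ S, c n • b n), ih,
          Lp.coeFn_smul (c n) (b n), coeFn_evalLp hμ.1 (h n)] with x a1 a2 a3 a4
        rw [a1, Pi.add_apply, a2, a3, Pi.smul_apply, hbn, a4, Finset.sum_insert hn, smul_eq_mul]
    filter_upwards [Lp.coeFn_sub K (∑ n ∈ S, c n • b n), hk.coeFn_toLp, h1] with x a1 a2 a3
    rw [a1, Pi.sub_apply, a2, a3]
  have hsum : Tendsto (fun S : Finset (Idx μ) => ∑ n ∈ S, c n • b n) atTop (𝓝 K) := by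
    have := b.hasSum_repr K
    simp only [hrepr] at this
    exact this
  constructor
  · simp only [hnorm]
    have h1 : Tendsto (fun S : Finset (Idx μ) => K - ∑ n ∈ S, c n • b n) atTop (𝓝 (K - K)) :=
      tendsto_const_nhds.sub hsum
    have h2 := (continuous_enorm.tendsto (K - K)).comp h1
    rw [sub_self, enorm_zero] at h2
    exact h2
  · intro S
    have hkn : eLpNorm k 2 μ = ‖K‖ₑ := by
      rw [Lp.enorm_def]
      exact eLpNorm_congr_ae hk.coeFn_toLp.symm
    rw [hnorm, hkn, enorm_le_iff_norm_le]
    refine (abs_le_of_sq_le_sq' ?_ (norm_nonneg _)).2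
    refine hasSum_le (fun n => ?_) (hasSum_repr_sq b _) (hasSum_repr_sq b K)
    have h1 : b.repr (∑ m ∈ S, c m • b m) n = if n ∈ S then c n else 0 := by
      rw [b.repr_apply_apply, inner_sum]
      simp only [inner_smul_right, orthonormal_iff_ite.1 b.orthonormal, mul_ite, mul_one, mul_zero]
      simp
    rw [map_sub, lp.coeFn_sub, Pi.sub_apply, h1, hrepr]
    split_ifs
    · simpa using sq_nonneg (c n)
    · rw [sub_zero]

lemma memLp_two_toReal {β : Type*} [MeasurableSpace β] {ρ : Measure β} {k : β → ℝ≥0∞}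
    (hk : Measurable k) (hk2 : ∫⁻ x, k x ^ 2 ∂ρ < ∞) : MemLp (fun x => (k x).toReal) 2 ρ := by
  rw [memLp_two_iff_integrable_sq hk.ennreal_toReal.aestronglyMeasurable]
  refine (integrable_toReal_of_lintegral_ne_top (hk.pow_const 2).aemeasurable hk2.ne).congr
    (ae_of_all _ fun x => ?_)
  simp

end Density

/-! ### Expansion of densities and finite-dimensional distributions -/

section Expansion

variable {μ : Measure ℝ} [IsProbabilityMeasure μ] {h : ℕ → Polynomial ℝ} {α : ℕ → ℝ}

/-- The expansion of a transition density with a fixed starting point `y`. -/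
lemma IsOrthonormalSystem.tendsto_density (hh : IsOrthonormalSystem μ h)
    (hμ : IdentifiableByMoments μ) {ρ : Measure ℝ} {t y : ℝ}
    (hcoef : ∀ n : Idx μ, ∫ x, evalLp hμ.1 (h n) x ∂ρ = Real.exp (-(α n * t)) * (h n).eval y)
    {k : ℝ → ℝ≥0∞} (hk : Measurable k) (hρ : ρ = μ.withDensity k) (hk2 : ∫⁻ x, k x ^ 2 ∂μ < ∞) :
    Tendsto (fun S : Finset (Idx μ) => eLpNorm (fun x => (k x).toReal -
        ∑ n ∈ S, Real.exp (-(α n * t)) * (h n).eval x * (h n).eval y) 2 μ) atTop (𝓝 0) ∧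
      ∀ S : Finset (Idx μ), eLpNorm (fun x => (k x).toReal -
        ∑ n ∈ S, Real.exp (-(α n * t)) * (h n).eval x * (h n).eval y) 2 μ ≤
          eLpNorm (fun x => (k x).toReal) 2 μ := by
  have := hh.tendsto_eLpNorm_sub_sum hμ (memLp_two_toReal hk hk2)
    (c := fun n => Real.exp (-(α n * t)) * (h n).eval y) fun n => by
      rw [integral_eval_mul_density hμ hk hρ hk2, hcoef]
  simp only [mul_right_comm _ (Polynomial.eval _ _) (Polynomial.eval y _)]
  exact this

/-- The expansion of a transition density in both variables. By Bessel's inequality the convergence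
for almost every starting point is dominated. -/
lemma IsOrthonormalSystem.tendsto_density_prod (hh : IsOrthonormalSystem μ h)
    (hμ : IdentifiableByMoments μ) {κ : Kernel ℝ ℝ} {t : ℝ}
    (hcoef : ∀ᵐ y ∂μ, ∀ n : Idx μ,
      ∫ x, evalLp hμ.1 (h n) x ∂(κ y) = Real.exp (-(α n * t)) * (h n).eval y)
    {g : ℝ × ℝ → ℝ≥0∞} (hg : Measurable g)
    (hκ : ∀ᵐ y ∂μ, κ y = μ.withDensity fun x => g (x, y))
    (hg2 : ∫⁻ z, g z ^ 2 ∂(μ.prod μ) < ∞) :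
    Tendsto (fun S : Finset (Idx μ) => eLpNorm (fun z : ℝ × ℝ => (g z).toReal -
      ∑ n ∈ S, Real.exp (-(α n * t)) * (h n).eval z.1 * (h n).eval z.2) 2 (μ.prod μ))
      atTop (𝓝 0) := by
  have hsq : ∀ {β : Type} [MeasurableSpace β] (ρ : Measure β) (f : β → ℝ),
      eLpNorm f 2 ρ = (∫⁻ x, ‖f x‖ₑ ^ 2 ∂ρ) ^ (1 / 2 : ℝ) := by
    intro β _ ρ f
    rw [eLpNorm_eq_lintegral_rpow_enorm_toReal (by norm_num) (by norm_num)]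
    simp
  have hsq' : ∀ {β : Type} [MeasurableSpace β] (ρ : Measure β) (f : β → ℝ),
      ∫⁻ x, ‖f x‖ₑ ^ 2 ∂ρ = eLpNorm f 2 ρ ^ 2 := by
    intro β _ ρ f
    rw [hsq, ← ENNReal.rpow_natCast, ← ENNReal.rpow_mul]
    norm_num
  have hpoly : ∀ p : Polynomial ℝ, Measurable fun x => p.eval x := fun p => p.continuous.measurable
  have hmeas : ∀ S : Finset (Idx μ), Measurable fun z : ℝ × ℝ => ‖(g z).toReal -
      ∑ n ∈ S, Real.exp (-(α n * t)) * (h n).eval z.1 * (h n).eval z.2‖ₑ ^ 2 := by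
    intro S
    refine Measurable.pow_const (Measurable.enorm (hg.ennreal_toReal.sub ?_)) 2
    refine Finset.measurable_sum _ fun n _ => ?_
    exact (((hpoly _).comp measurable_fst).const_mul _).mul ((hpoly _).comp measurable_snd)
  have hg2' : ∫⁻ y, ∫⁻ x, g (x, y) ^ 2 ∂μ ∂μ < ∞ := by
    rwa [← lintegral_prod_symm' _ (hg.pow_const 2)]
  have hae : ∀ᵐ y ∂μ, ∫⁻ x, g (x, y) ^ 2 ∂μ < ∞ :=
    ae_lt_top (hg.pow_const 2).lintegral_prod_left' hg2'.ne
  have hlim : Tendsto (fun S : Finset (Idx μ) => ∫⁻ y, ∫⁻ x, ‖(g (x, y)).toReal -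
      ∑ n ∈ S, Real.exp (-(α n * t)) * (h n).eval x * (h n).eval y‖ₑ ^ 2 ∂μ ∂μ) atTop
      (𝓝 (∫⁻ _, 0 ∂μ)) := by
    refine tendsto_lintegral_filter_of_dominated_convergence
      (fun y => ∫⁻ x, g (x, y) ^ 2 ∂μ) (Eventually.of_forall fun S =>
        (hmeas S).lintegral_prod_left') (Eventually.of_forall fun S => ?_) hg2'.ne ?_
    · filter_upwards [hcoef, hκ, hae] with y h1 h2 h3
      have h4 := (hh.tendsto_density hμ h1 (hg.comp measurable_prodMk_right) h2 h3).2 S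
      rw [hsq' μ]
      refine (pow_le_pow_left' h4 2).trans ?_
      rw [← hsq' μ]
      refine lintegral_mono fun x => pow_le_pow_left' ?_ 2
      rw [Function.comp_apply, Real.enorm_eq_ofReal ENNReal.toReal_nonneg]
      exact ENNReal.ofReal_toReal_le
    · filter_upwards [hcoef, hκ, hae] with y h1 h2 h3
      have h4 := (hh.tendsto_density hμ h1 (hg.comp measurable_prodMk_right) h2 h3).1
      simp only [hsq' μ]
      have h5 := ((ENNReal.continuous_pow 2).tendsto 0).comp h4
      rw [zero_pow two_ne_zero] at h5
      exact h5
  simp only [hsq, lintegral_prod_symm' _ (hmeas _)]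
  rw [lintegral_zero] at hlim
  have := ((ENNReal.continuous_rpow_const (y := 1 / 2)).tendsto 0).comp hlim
  rw [ENNReal.zero_rpow_of_pos (by norm_num)] at this
  exact this

end Expansion

section FiniteDimensional

/-- Adjoins the state at time `m` to the states at the times in `I`. -/
noncomputable def insertState (m : ℝ) (I : Finset ℝ) (z : (I → ℝ) × ℝ) :
    ↥(insert m I) → ℝ :=
  fun i => if hi : (i : ℝ) ∈ I then z.1 ⟨i, hi⟩ else z.2

lemma measurable_insertState (m : ℝ) (I : Finset ℝ) : Measurable (insertState m I) := by
  refine measurable_pi_lambda _ fun i => ?_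
  by_cases hi : (i : ℝ) ∈ I
  · simp only [insertState, hi, dite_true]
    exact (measurable_pi_apply _).comp measurable_fst
  · simp only [insertState, hi, dite_false]
    exact measurable_snd

lemma insertState_comp {Ω : Type*} (X : ℝ → Ω → ℝ) (m : ℝ) (I : Finset ℝ) :
    (insertState m I ∘ fun ω => ((fun i : I => X i ω), X m ω)) =
      fun ω (i : ↥(insert m I)) => X i ω := by
  ext ω i
  simp only [Function.comp_apply, insertState]
  split_ifs with hi
  · rfl
  · rw [(Finset.mem_insert.1 i.2).resolve_right hi]

lemma map_eq_map_of_subsingleton {Ω Ω' β : Type*} [MeasurableSpace Ω] [MeasurableSpace Ω']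
    [MeasurableSpace β] [Subsingleton β] {P : Measure Ω} {P' : Measure Ω'}
    [IsProbabilityMeasure P] [IsProbabilityMeasure P'] {F : Ω → β} {F' : Ω' → β}
    (hF : Measurable F) (hF' : Measurable F') : P.map F = P'.map F' := by
  ext A hA
  rw [Measure.map_apply hF hA, Measure.map_apply hF' hA]
  rcases A.eq_empty_or_nonempty with rfl | hne
  · simp
  · rw [Subsingleton.eq_univ_of_nonempty hne]
    simp

variable {Ω : Type u} [MeasurableSpace Ω] {P : Measure Ω} [IsProbabilityMeasure P]
  {X : ℝ → Ω → ℝ} {hX : ∀ t, StronglyMeasurable (X t)} {μ : Measure ℝ}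

/-- The transition operators express the joint law of past states and one later state through the
law of the past states. -/
lemma measureReal_past_inter_eq_setIntegral [IsFiniteMeasure μ]
    (hmp : ∀ t, MeasurePreserving (X t) P μ)
    {T : ℝ≥0 → Lp ℝ 2 μ → Lp ℝ 2 μ}
    (hT : ∀ (s : ℝ) (t : ℝ≥0) (f : Lp ℝ 2 μ),
      P[fun ω => f (X (s + t) ω) | Filtration.natural X hX s] =ᵐ[P] fun ω => T t f (X s ω))
    {I : Finset ℝ} (s : I) (hs : ∀ i ∈ I, i ≤ s) (t : ℝ≥0) {A : Set (I → ℝ)}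
    (hA : MeasurableSet A) {B : Set ℝ} (hB : MeasurableSet B) :
    P.real ((fun ω (i : I) => X i ω) ⁻¹' A ∩ X (s + t) ⁻¹' B) =
      ∫ x in A, T t (indicatorConstLp 2 hB (measure_ne_top μ B) 1) (x s)
        ∂(P.map fun ω (i : I) => X i ω) := by
  have hXm : ∀ r, Measurable (X r) := fun r => (hX r).measurable
  have hI : Measurable fun ω (i : I) => X i ω := measurable_pi_lambda _ fun i => hXm i
  have hA' : MeasurableSet[Filtration.natural X hX s] ((fun ω (i : I) => X i ω) ⁻¹' A) := by
    have : Measurable[Filtration.natural X hX s] fun ω (i : I) => X i ω :=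
      @measurable_pi_lambda Ω I (fun _ => ℝ) (Filtration.natural X hX s) _ _ fun i =>
        ((stronglyMeasurable_natural hX i).mono
          ((Filtration.natural X hX).mono (hs i i.2))).measurable
    exact this hA
  set f : Lp ℝ 2 μ := indicatorConstLp 2 hB (measure_ne_top μ B) 1 with hf
  have hfi : Integrable (fun ω => f (X (s + t) ω)) P :=
    ((Lp.memLp f).comp_measurePreserving (hmp _)).integrable (by norm_num)
  have h1 := setIntegral_condExp ((Filtration.natural X hX).le s) hfi hA'
  have h2 : ∀ᵐ ω ∂P, f (X (s + t) ω) = (X (s + t) ⁻¹' B).indicator (fun _ => (1 : ℝ)) ω := by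
    filter_upwards [(hmp (s + t)).quasiMeasurePreserving.ae_eq_comp
      (indicatorConstLp_coeFn (p := 2) (hs := hB) (hμs := measure_ne_top μ B) (c := (1 : ℝ)))]
      with ω hω
    exact hω
  rw [setIntegral_congr_ae (hI hA) ((hT s t f).mono fun ω hω _ => hω),
    setIntegral_congr_ae (hI hA) (h2.mono fun ω hω _ => hω),
    setIntegral_indicator (hXm _ hB), setIntegral_const, smul_eq_mul, mul_one] at h1
  rw [← h1, setIntegral_map hA _ hI.aemeasurable]
  exact ((Lp.stronglyMeasurable _).comp_measurable (measurable_pi_apply s)).aestronglyMeasurable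

/-- Two stationary processes with the same one-dimensional law and the same transition operators
have the same finite-dimensional distributions. -/
lemma sameFiniteDimensionalLaws_of_transition_eq {Ω' : Type v} [MeasurableSpace Ω']
    {P' : Measure Ω'} [IsProbabilityMeasure P'] {X' : ℝ → Ω' → ℝ}
    {hX' : ∀ t, StronglyMeasurable (X' t)} [IsFiniteMeasure μ]
    (hmp : ∀ t, MeasurePreserving (X t) P μ) (hmp' : ∀ t, MeasurePreserving (X' t) P' μ)
    {T : ℝ≥0 → Lp ℝ 2 μ → Lp ℝ 2 μ}
    (hT : ∀ (s : ℝ) (t : ℝ≥0) (f : Lp ℝ 2 μ),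
      P[fun ω => f (X (s + t) ω) | Filtration.natural X hX s] =ᵐ[P] fun ω => T t f (X s ω))
    (hT' : ∀ (s : ℝ) (t : ℝ≥0) (f : Lp ℝ 2 μ),
      P'[fun ω => f (X' (s + t) ω) | Filtration.natural X' hX' s] =ᵐ[P']
        fun ω => T t f (X' s ω)) :
    SameFiniteDimensionalLaws P X P' X' := by
  have hXm : ∀ r, Measurable (X r) := fun r => (hX r).measurable
  have hXm' : ∀ r, Measurable (X' r) := fun r => (hX' r).measurable
  intro I
  induction I using Finset.induction_on_max with
  | empty =>
    exact map_eq_map_of_subsingleton (β := ↥(∅ : Finset ℝ) → ℝ)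
      (measurable_pi_lambda _ fun i => hXm i) (measurable_pi_lambda _ fun i => hXm' i)
  | insert m I hmax ih =>
    have hI : Measurable fun ω (i : I) => X i ω := measurable_pi_lambda _ fun i => hXm i
    have hI' : Measurable fun ω (i : I) => X' i ω := measurable_pi_lambda _ fun i => hXm' i
    have hpair : P.map (fun ω => ((fun i : I => X i ω), X m ω)) =
        P'.map fun ω => ((fun i : I => X' i ω), X' m ω) := by
      have : IsProbabilityMeasure (P.map fun ω => ((fun i : I => X i ω), X m ω)) :=
        Measure.isProbabilityMeasure_map (hI.prodMk (hXm m)).aemeasurable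
      refine Measure.ext_prod fun {A B} hA hB => ?_
      rw [Measure.map_apply (hI.prodMk (hXm m)) (hA.prod hB),
        Measure.map_apply (hI'.prodMk (hXm' m)) (hA.prod hB)]
      change P ((fun ω (i : I) => X i ω) ⁻¹' A ∩ X m ⁻¹' B) =
        P' ((fun ω (i : I) => X' i ω) ⁻¹' A ∩ X' m ⁻¹' B)
      rcases I.eq_empty_or_nonempty with hIe | hne
      · subst hIe
        rcases A.eq_empty_or_nonempty with rfl | hne
        · simp
        · rw [Subsingleton.eq_univ_of_nonempty hne]
          simp only [Set.preimage_univ, Set.univ_inter]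
          rw [(hmp m).measure_preimage hB.nullMeasurableSet,
            (hmp' m).measure_preimage hB.nullMeasurableSet]
      · set s : I := ⟨I.max' hne, I.max'_mem hne⟩ with hs
        have hsI : ∀ i ∈ I, i ≤ s := fun i hi => I.le_max' i hi
        have hsm : (s : ℝ) < m := hmax _ s.2
        obtain ⟨t, ht⟩ : ∃ t : ℝ≥0, (s : ℝ) + t = m :=
          ⟨(m - s).toNNReal, by rw [Real.coe_toNNReal _ (by linarith)]; ring⟩
        have h1 := measureReal_past_inter_eq_setIntegral hmp hT s hsI t hA hB
        have h2 := measureReal_past_inter_eq_setIntegral hmp' hT' s hsI t hA hB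
        rw [← ih, ← h1, ht] at h2
        exact ((ENNReal.toReal_eq_toReal_iff' (measure_ne_top _ _) (measure_ne_top _ _)).1 h2).symm
    rw [← insertState_comp X m I, ← insertState_comp X' m I,
      ← Measure.map_map (measurable_insertState m I) (hI.prodMk (hXm m)),
      ← Measure.map_map (measurable_insertState m I) (hI'.prodMk (hXm' m)), hpair]

end FiniteDimensional

end PolyRegression

theorem mainTheorem1 {Ω : Type u} [MeasurableSpace Ω] (P : Measure Ω) [IsProbabilityMeasure P]
    (X : ℝ → Ω → ℝ) (hX : ∀ t, StronglyMeasurable (X t))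
    (μ : Measure ℝ) (η : ℝ≥0 → Kernel ℝ ℝ)
    (hR : PolyRegression.IsRSMPR P X hX μ η) :
    (∃ (h : ℕ → Polynomial ℝ) (α : ℕ → ℝ)
        (b : HilbertBasis (PolyRegression.Idx μ) ℝ (Lp ℝ 2 μ))
        (U : ℝ≥0 → Lp ℝ 2 μ →L[ℝ] Lp ℝ 2 μ) (A : Lp ℝ 2 μ →ₗ.[ℝ] Lp ℝ 2 μ),
      -- orthonormal polynomials and orthogonal martingales
      h 0 = 1 ∧ α 0 = 0 ∧
      PolyRegression.IsMartingaleSystem P X hX μ h α ∧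
      -- the `h n` form an orthonormal basis `b` of `L²(μ)`
      (∀ n : PolyRegression.Idx μ, (b n : ℝ → ℝ) =ᵐ[μ] fun x => (h n).eval x) ∧
      -- the semigroup and its diagonal form
      (∀ (t : ℝ≥0) (f : Lp ℝ 2 μ),
        HasSum (fun n : PolyRegression.Idx μ => (Real.exp (-(α n * t)) * b.repr f n) • b n)
          (U t f)) ∧
      PolyRegression.IsStronglyContinuousSemigroup U ∧
      -- `U` consists of the transition operators of the process
      (∀ (t : ℝ≥0) (f : Lp ℝ 2 μ),
        P[fun ω => f (X t ω) | MeasurableSpace.comap (X 0) inferInstance]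
          =ᵐ[P] fun ω => U t f (X 0 ω)) ∧
      (∀ (s : ℝ) (t : ℝ≥0) (f : Lp ℝ 2 μ),
        P[fun ω => f (X (s + t) ω) | Filtration.natural X hX s]
          =ᵐ[P] fun ω => U t f (X s ω)) ∧
      (∀ (t : ℝ≥0) (f : Lp ℝ 2 μ),
        ∀ᵐ y ∂μ, Integrable f (η t y) ∧ U t f y = ∫ x, f x ∂(η t y)) ∧
      -- the generator, its domain and its diagonal form
      PolyRegression.IsInfinitesimalGenerator U A ∧
      (∀ f : Lp ℝ 2 μ, f ∈ A.domain ↔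
        Summable fun n : PolyRegression.Idx μ => b.repr f n ^ 2 * α n ^ 2) ∧
      (∀ f : A.domain,
        HasSum (fun n : PolyRegression.Idx μ => -(α n * b.repr (f : Lp ℝ 2 μ) n) • b n) (A f)) ∧
      -- the expansion of the density, in `L²(μ)` for almost every starting point
      (∀ t : ℝ≥0, ∀ᵐ y ∂μ, η t y ≪ μ → ∫⁻ x, (η t y).rnDeriv μ x ^ 2 ∂μ < ∞ →
        Tendsto (fun S : Finset (PolyRegression.Idx μ) =>
          eLpNorm (fun x => ((η t y).rnDeriv μ x).toReal -
            ∑ n ∈ S, Real.exp (-(α n * t)) * (h n).eval x * (h n).eval y) 2 μ) atTop (𝓝 0)) ∧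
      -- the expansion of the density, in `L²(μ ⊗ μ)`
      (∀ (t : ℝ≥0) (g : ℝ × ℝ → ℝ≥0∞), Measurable g →
        (∀ᵐ y ∂μ, η t y = μ.withDensity fun x => g (x, y)) →
        ∫⁻ z, g z ^ 2 ∂(μ.prod μ) < ∞ →
        Tendsto (fun S : Finset (PolyRegression.Idx μ) =>
          eLpNorm (fun z : ℝ × ℝ => (g z).toReal -
            ∑ n ∈ S, Real.exp (-(α n * t)) * (h n).eval z.1 * (h n).eval z.2) 2 (μ.prod μ))
          atTop (𝓝 0))) ∧
    -- the system of polynomials and constants determines the process (together with the support,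
    -- if that is finite)
    (∀ {Ω' : Type v} [MeasurableSpace Ω'] (P' : Measure Ω') [IsProbabilityMeasure P']
        (X' : ℝ → Ω' → ℝ) (hX' : ∀ t, StronglyMeasurable (X' t))
        (μ' : Measure ℝ) (η' : ℝ≥0 → Kernel ℝ ℝ),
      PolyRegression.IsRSMPR P' X' hX' μ' η' →
      ((PolyRegression.supportSize μ = ⊤ ∧ PolyRegression.supportSize μ' = ⊤) ∨
        μ'.support = μ.support) →
      ∀ (h : ℕ → Polynomial ℝ) (α : ℕ → ℝ),
        PolyRegression.IsMartingaleSystem P X hX μ h α →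
        PolyRegression.IsMartingaleSystem P' X' hX' μ' h α →
        PolyRegression.SameFiniteDimensionalLaws P X P' X') := by
  refine ⟨?_, ?_⟩
  · obtain ⟨h, α, h0, α0, hM⟩ := hR.exists_isMartingaleSystem
    obtain ⟨γ, hS, -⟩ := hR
    have := hS.isProbabilityMeasure
    have hμ := hS.identifiable
    have hmp := hS.measurePreserving
    have hh := hM.isOrthonormalSystem
    have hbn : ∀ n, hh.hilbertBasis hμ n = PolyRegression.evalLp hμ.1 (h n) :=
      hh.hilbertBasis_apply hμ
    have hcond := fun s t f => hM.condExp_eq_semigroup hμ hmp s t f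
    have hcomap := fun (t : ℝ≥0) (f : Lp ℝ 2 μ) =>
      PolyRegression.condExp_comap_eq_of_condExp_natural_eq hmp (hcond 0 t f)
    have hker := fun (t : ℝ≥0) (f : Lp ℝ 2 μ) => hS.ae_integrable_and_eq_integral t (hcomap t f)
    have hcoef : ∀ t : ℝ≥0, ∀ᵐ y ∂μ, ∀ n : PolyRegression.Idx μ,
        ∫ x, PolyRegression.evalLp hμ.1 (h n) x ∂(η t y) =
          Real.exp (-(α n * t)) * (h n).eval y := by
      intro t
      rw [ae_all_iff]
      intro n
      have h2 : hM.semigroup hμ t (PolyRegression.evalLp hμ.1 (h n)) =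
          Real.exp (-(α n * t)) • PolyRegression.evalLp hμ.1 (h n) := by
        rw [← hbn]
        exact PolyRegression.diagonalSemigroup_basis _ _ _ _ _
      filter_upwards [hker t (PolyRegression.evalLp hμ.1 (h n)),
        Lp.coeFn_smul (Real.exp (-(α n * t))) (PolyRegression.evalLp hμ.1 (h n)),
        PolyRegression.coeFn_evalLp hμ.1 (h n)] with y a1 a2 a3
      rw [← a1.2, h2, a2, Pi.smul_apply, a3, smul_eq_mul]
    refine ⟨h, α, hh.hilbertBasis hμ, hM.semigroup hμ,
      PolyRegression.diagonalGenerator (hh.hilbertBasis hμ) fun n => α n, h0, α0, hM, fun n => ?_,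
      PolyRegression.hasSum_diagonalSemigroup _ _ hM.nonneg,
      PolyRegression.isStronglyContinuousSemigroup_diagonalSemigroup _ _ hM.nonneg,
      hcomap, hcond, hker,
      PolyRegression.isInfinitesimalGenerator_diagonalGenerator _ _ hM.nonneg,
      PolyRegression.mem_domain_diagonalGenerator _ _,
      PolyRegression.hasSum_diagonalGenerator _ _, fun t => ?_, fun t g hg hgη hg2 => ?_⟩
    · rw [hbn]
      exact PolyRegression.coeFn_evalLp hμ.1 _
    · have := hS.isMarkovKernel t
      filter_upwards [hcoef t] with y hy hac hy2
      exact (hh.tendsto_density hμ hy (Measure.measurable_rnDeriv _ _)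
        (Measure.withDensity_rnDeriv_eq _ _ hac).symm hy2).1
    · exact hh.tendsto_density_prod hμ (hcoef t) hg hgη hg2
  · intro Ω' _ P' _ X' hX' μ' η' hR' hsupp h α hM hM'
    obtain ⟨γ, hS, -⟩ := hR
    obtain ⟨γ', hS', -⟩ := hR'
    have := hS.isProbabilityMeasure
    have := hS'.isProbabilityMeasure
    obtain rfl : μ' = μ := hM.isOrthonormalSystem.measure_unique hM'.isOrthonormalSystem
      hS.identifiable hS'.identifiable hsupp
    -- The transition semigroup is built from the polynomials and constants alone.
    exact PolyRegression.sameFiniteDimensionalLaws_of_transition_eq hS.measurePreserving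
      hS'.measurePreserving (T := fun t f => hM.semigroup hS.identifiable t f)
      (fun s t f => hM.condExp_eq_semigroup hS.identifiable hS.measurePreserving s t f)
      (fun s t f => hM'.condExp_eq_semigroup hS'.identifiable hS'.measurePreserving s t f)
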